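/- Let $A\in\mathbb R^{n\times n}$, $B\in\mathbb R^{n\times m}$, let $Q\in\mathbb R^{n\times n}$ be symmetric positive semidefinite, $R\in\mathbb R^{m\times m}$ symmetric positive definite, and let $x^1,\dots,x^n\in\mathbb R^n$ be linearly independent. Let $$\mathcal S=\{K\in\mathbb R^{m\times n}:\rho(A-BK)<1\}$$ be the set of Schur stabilizing feedback gains ($\rho$ is the spectral radius), and for $K\in\mathcal S$ let $$f(K)=\sum_{j=1}^n\sum_{k=0}^\infty\Big[\big\langle (A-BK)^kx^j,\,Q(A-BK)^kx^j\big\rangle+\big\langle K(A-BK)^kx^j,\,RK(A-BK)^kx^j\big\rangle\Big].$$ Let $\nabla f$ be the gradient of $f$ with respect to the Frobenius inner product $\langle E,F\rangle=\operatorname{Tr}(E^\top F)$, and let $K_0\in\mathcal S$. If $Q\succ0$, then $f$ has a global minimizer over $\mathcal S$. Further, whenever $f$ has a global minimizer $K_*$ over $\mathcal S$ (in particular if $Q\succ 0$), this minimizer is unique, and the following hold. 1. The gradient flow $\dot K_t=-\nabla f(K_t)$ with initial value $K_0$ at $t=0$ has a solution $K_t$ that is defined, and stays in $\mathcal S$,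 for all $t\ge0$. It is $C^\infty$ on $[0,\infty)$, and it is unique: every solution in $\mathcal S$ with the same initial value on an interval $I\subseteq[0,\infty)$ containing $0$ agrees with it on $I$. 2. There are constants $\alpha>0$ and $c>0$, depending only on $A,B,Q,R,x^1,\dots,x^n$ and $K_0$, such that for all $t\ge 0$ $$f(K_t)-f(K_*)\le e^{-\alpha t}\,\big(f(K_0)-f(K_*)\big)\qquad\text{and}\qquad \|K_t-K_*\|_F^2\le c\,e^{-\alpha t}\,\|K_0-K_*\|_F^2 ,$$ that is, the trajectory is globally exponentially stable in the sense of Lyapunov. -/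

import Mathlib

open Matrix Set
open scoped Gradient ContDiff

/-! The space of `m × n` real matrices carries the Frobenius norm and the Frobenius inner product
`⟪E, F⟫ = Tr (Eᵀ F)`. -/

attribute [local instance] Matrix.frobeniusNormedAddCommGroup

/-- The Frobenius inner product on real matrices; its norm is the Frobenius norm. -/
@[reducible] noncomputable def frobeniusInnerProductSpace {m n : ℕ} :
    InnerProductSpace ℝ (Matrix (Fin m) (Fin n) ℝ) :=
  { Matrix.frobeniusNormedSpace with
    inner := fun E F => (Eᵀ * F).trace
    norm_sq_eq_re_inner := by
      intro E
      have h : (0 : ℝ) ≤ ∑ i, ∑ j, ‖E i j‖ ^ (2 : ℝ) := by positivity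
      rw [Matrix.frobenius_norm_def, ← Real.sqrt_eq_rpow, Real.sq_sqrt h, Finset.sum_comm]
      simp [Matrix.trace, Matrix.mul_apply, pow_two]
    conj_inner_symm := by
      intro E F
      simp only [conj_trivial]
      rw [← Matrix.trace_transpose, Matrix.transpose_mul, Matrix.transpose_transpose]
    add_left := by
      intro E F G
      simp [Matrix.add_mul, Matrix.trace_add]
    smul_left := by
      intro E F r
      simp [Matrix.trace_smul] }

attribute [local instance] frobeniusInnerProductSpace

namespace LQR

variable {m n : ℕ}

/-- The set `𝒮` of Schur stabilizing feedback gains: all `K` such that `ρ(A - B K) < 1`, where `ρ` is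
the spectral radius, i.e. the largest modulus of a complex eigenvalue. -/
def stabilizing (A : Matrix (Fin n) (Fin n) ℝ) (B : Matrix (Fin n) (Fin m) ℝ) :
    Set (Matrix (Fin m) (Fin n) ℝ) :=
  {K | spectralRadius ℂ ((A - B * K).map (algebraMap ℝ ℂ)) < 1}

/-- The cost of stage `k` of the closed loop `x_{k+1} = A x_k + B u_k`, `u_k = -K x_k` started at `x`:
it equals `⟨x_k, Q x_k⟩ + ⟨u_k, R u_k⟩` with `x_k = (A - B K)^k x`. -/
noncomputable def stageCost (A : Matrix (Fin n) (Fin n) ℝ) (B : Matrix (Fin n) (Fin m) ℝ)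
    (Q : Matrix (Fin n) (Fin n) ℝ) (R : Matrix (Fin m) (Fin m) ℝ)
    (x : Fin n → ℝ) (K : Matrix (Fin m) (Fin n) ℝ) (k : ℕ) : ℝ :=
  (((A - B * K) ^ k) *ᵥ x) ⬝ᵥ (Q *ᵥ (((A - B * K) ^ k) *ᵥ x)) +
    (K *ᵥ (((A - B * K) ^ k) *ᵥ x)) ⬝ᵥ (R *ᵥ (K *ᵥ (((A - B * K) ^ k) *ᵥ x)))

open Filter Asymptotics in
/-- If `ρ(M) < 1`, the entries of `M ^ k` decay geometrically. -/
theorem pow_apply_isBigO (M : Matrix (Fin n) (Fin n) ℝ)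
    (hM : spectralRadius ℂ (M.map (algebraMap ℝ ℂ)) < 1) :
    ∃ r : ℝ, 0 ≤ r ∧ r < 1 ∧ ∀ i j, (fun k : ℕ => (M ^ k) i j) =O[atTop] fun k => r ^ k := by
  let _ := Matrix.frobeniusNormedRing (m := Fin n) (α := ℂ)
  let _ := Matrix.frobeniusNormedAlgebra (m := Fin n) (R := ℂ) (α := ℂ)
  obtain ⟨r, hr, hr1⟩ := ENNReal.lt_iff_exists_nnreal_btwn.1 hM
  have hr1' : r < 1 := by exact_mod_cast hr1
  refine ⟨r, r.2, by exact_mod_cast hr1', fun i j => ?_⟩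
  have hlim := spectrum.pow_nnnorm_pow_one_div_tendsto_nhds_spectralRadius
    (M.map (algebraMap ℝ ℂ))
  have hev := hlim.eventually (gt_mem_nhds hr)
  refine IsBigO.of_bound 1 ?_
  filter_upwards [hev, eventually_gt_atTop 0] with k hk hk0
  have hk0' : (0 : ℝ) < k := by exact_mod_cast hk0
  have h1 : (‖(M.map (algebraMap ℝ ℂ)) ^ k‖₊ : ENNReal) ≤ (r : ENNReal) ^ (k : ℝ) := by
    have h := ENNReal.rpow_le_rpow hk.le hk0'.le
    rwa [← ENNReal.rpow_mul, one_div, inv_mul_cancel₀ hk0'.ne', ENNReal.rpow_one] at h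
  rw [ENNReal.rpow_natCast] at h1
  have h2 : ‖(M.map (algebraMap ℝ ℂ)) ^ k‖ ≤ (r : ℝ) ^ k := by exact_mod_cast h1
  have h3 : (M.map (algebraMap ℝ ℂ)) ^ k = (M ^ k).map (algebraMap ℝ ℂ) :=
    (map_pow (algebraMap ℝ ℂ).mapMatrix M k).symm
  have h4 : ‖(M ^ k) i j‖ ≤ ‖(M.map (algebraMap ℝ ℂ)) ^ k‖ := by
    rw [h3, Matrix.frobenius_norm_map_eq _ _ (by intro a; simp), Matrix.frobenius_norm_def,
      ← Real.sqrt_eq_rpow]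
    apply Real.le_sqrt_of_sq_le
    have h5 : ‖(M ^ k) i j‖ ^ 2 = ‖(M ^ k) i j‖ ^ (2 : ℝ) := by norm_num
    rw [h5]
    calc _ ≤ ∑ b, ‖(M ^ k) i b‖ ^ (2 : ℝ) :=
          Finset.single_le_sum (f := fun b => ‖(M ^ k) i b‖ ^ (2 : ℝ))
            (fun _ _ => by positivity) (Finset.mem_univ j)
      _ ≤ _ := Finset.single_le_sum (f := fun a => ∑ b, ‖(M ^ k) a b‖ ^ (2 : ℝ))
            (fun _ _ => by positivity) (Finset.mem_univ i)
  have h6 : ‖(r : ℝ) ^ k‖ = (r : ℝ) ^ k := by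
    rw [Real.norm_of_nonneg]; positivity
  rw [one_mul, h6]
  exact h4.trans h2

open Filter Asymptotics in
/-- For a stabilizing gain the series that defines the cost converges. -/
theorem summable_stageCost (A : Matrix (Fin n) (Fin n) ℝ) (B : Matrix (Fin n) (Fin m) ℝ)
    (Q : Matrix (Fin n) (Fin n) ℝ) (R : Matrix (Fin m) (Fin m) ℝ)
    (x : Fin n → ℝ) (K : Matrix (Fin m) (Fin n) ℝ) (hK : K ∈ stabilizing A B) :
    Summable (stageCost A B Q R x K) := by
  obtain ⟨r, hr0, hr1, hO⟩ := pow_apply_isBigO (A - B * K) hK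
  have hmul : ∀ {p q : ℕ} (N : Matrix (Fin p) (Fin q) ℝ) (z : ℕ → Fin q → ℝ),
      (∀ j, (fun k => z k j) =O[atTop] fun k => r ^ k) →
      ∀ i, (fun k => (N *ᵥ z k) i) =O[atTop] fun k => r ^ k := by
    intro p q N z hz i
    simp only [Matrix.mulVec, dotProduct]
    exact IsBigO.fun_sum fun j _ => (hz j).const_mul_left _
  have hdot : ∀ {p : ℕ} (y z : ℕ → Fin p → ℝ),
      (∀ j, (fun k => y k j) =O[atTop] fun k => r ^ k) →
      (∀ j, (fun k => z k j) =O[atTop] fun k => r ^ k) →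
      (fun k => y k ⬝ᵥ z k) =O[atTop] fun k => r ^ k * r ^ k := by
    intro p y z hy hz
    simp only [dotProduct]
    exact IsBigO.fun_sum fun j _ => (hy j).mul (hz j)
  have hs : ∀ j, (fun k : ℕ => (((A - B * K) ^ k) *ᵥ x) j) =O[atTop] fun k => r ^ k := by
    intro j
    simp only [Matrix.mulVec, dotProduct]
    refine IsBigO.fun_sum fun l _ => ?_
    simpa [mul_comm] using (hO j l).const_mul_left (x l)
  have hsum : Summable fun k : ℕ => r ^ k * r ^ k := by
    simp only [← mul_pow]
    exact summable_geometric_of_lt_one (by positivity) (by nlinarith)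
  exact summable_of_isBigO_nat hsum
    ((hdot _ _ hs (hmul Q _ hs)).add (hdot _ _ (hmul K _ hs) (hmul R _ (hmul K _ hs))))

/-- The infinite horizon cost `J_x(K)`. The series converges for every stabilizing `K`
(`summable_stageCost`), and only such `K` are ever considered. -/
noncomputable def costFrom (A : Matrix (Fin n) (Fin n) ℝ) (B : Matrix (Fin n) (Fin m) ℝ)
    (Q : Matrix (Fin n) (Fin n) ℝ) (R : Matrix (Fin m) (Fin m) ℝ)
    (x : Fin n → ℝ) (K : Matrix (Fin m) (Fin n) ℝ) : ℝ :=
  ∑' k : ℕ, stageCost A B Q R x K k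

/-- The LQR cost `f(K) = ∑ⱼ J_{xⱼ}(K)` for the initial states `x₁, …, xₙ`. -/
noncomputable def cost (A : Matrix (Fin n) (Fin n) ℝ) (B : Matrix (Fin n) (Fin m) ℝ)
    (Q : Matrix (Fin n) (Fin n) ℝ) (R : Matrix (Fin m) (Fin m) ℝ)
    (x : Fin n → Fin n → ℝ) (K : Matrix (Fin m) (Fin n) ℝ) : ℝ :=
  ∑ j, costFrom A B Q R (x j) K

/-- `Kstar` is a global minimizer over `S` of the function `f`. -/
def IsGlobalMin (f : Matrix (Fin m) (Fin n) ℝ → ℝ) (S : Set (Matrix (Fin m) (Fin n) ℝ))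
    (Kstar : Matrix (Fin m) (Fin n) ℝ) : Prop :=
  Kstar ∈ S ∧ ∀ K ∈ S, f Kstar ≤ f K

/-- On the set of times `I`, the curve `K` stays in `S`, and there it solves the gradient flow
`K̇ = -∇f(K)`, with the gradient (which has to exist along the curve) taken with respect to the
Frobenius inner product. At an end point of `I` the derivative is one-sided. -/
def IsGradientFlow (f : Matrix (Fin m) (Fin n) ℝ → ℝ) (S : Set (Matrix (Fin m) (Fin n) ℝ))
    (K : ℝ → Matrix (Fin m) (Fin n) ℝ) (I : Set ℝ) : Prop :=
  ∀ t ∈ I, K t ∈ S ∧ DifferentiableAt ℝ f (K t) ∧ HasDerivWithinAt K (-∇ f (K t)) I t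

end LQR

/-! Write M = A - BK and let Σ be the Gram matrix of the initial states. Let Y_K solve Y = Σ + M Y
Mᵀ and X_K solve X = Q + KᵀRK + MᵀXM. Then f(K) = Tr((Q + KᵀRK) Y_K) = Tr(X_K Σ). Using the first
form at K' and the second at K gives the exact expansion `LQR.cost_sub_cost` f(K') - f(K) = Tr(DᵀG_K
D Y_{K'}) + 2 Tr(DᵀE_K Y_{K'}), where D = K' - K, G_K = R + BᵀX_K B and E_K = RK - BᵀX_K M.

Everything else is read off from it. Letting K' → K gives ∇f(K) = 2 E_K Y_K. Fixing K' and
completing the square in D gives a Polyak-Łojasiewicz inequality (`LQR.exists_gradient_dominated`),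
because G_K ⪰ R and Y_K ⪰ Σ ≻ 0 uniformly in K. At a minimizer E vanishes, so f grows at least
quadratically, and the minimizer is unique.

The sublevel sets are compact in the open set of stabilizing gains: bounding Tr Y_K bounds ∑‖Mᵏ‖²,
and a bound on all partial sums is a closed condition that forces stability. If Q ≻ 0, the cost
bounds Tr Y_K directly. Otherwise the minimizer serves as a stable reference, and the excess cost
bounds the perturbation of its closed loop (`LQR.exists_trace_stateGram_le`).

On a compact sublevel set the gradient field can be cut off to a complete one, so the flow exists
for all time. The Polyak-Łojasiewicz inequality yields decay of the cost, and quadratic growth turns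
it into decay of the distance. -/

section GradientFlow

open scoped Topology NNReal RealInnerProductSpace Manifold

/-! ### Global flows of bounded Lipschitz fields, smoothness in time, cutoffs -/

section Existence

variable {E : Type*} [NormedAddCommGroup E] [NormedSpace ℝ E]

/-- A bounded Lipschitz vector field on a Banach space is complete. -/
theorem exists_hasDerivAt_of_lipschitzWith_of_norm_le [CompleteSpace E] {v : E → E} {C b : ℝ≥0}
    (hv : LipschitzWith C v) (hb : ∀ x, ‖v x‖ ≤ b) (x₀ : E) :
    ∃ γ : ℝ → E, γ 0 = x₀ ∧ ∀ t, HasDerivAt γ (v (γ t)) t := by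
  have hloc : ∀ N : ℕ, ∃ α : ℝ → E, α 0 = x₀ ∧
      ∀ t ∈ Ioo (-(N : ℝ)) N, HasDerivAt α (v (α t)) t := by
    intro N
    have h0 : (0 : ℝ) ∈ Icc (-(N : ℝ)) N := by simp
    -- The speed is at most `b`, so within time `N` a solution cannot leave the ball of radius `b *
    -- N`.
    have hPL : IsPicardLindelof (fun _ => v) (⟨0, h0⟩ : Icc (-(N : ℝ)) N) x₀ (b * N) 0 b C :=
      IsPicardLindelof.of_time_independent (fun x _ => hb x) hv.lipschitzOnWith (by simp)
    obtain ⟨α, hα0, hα⟩ := hPL.exists_eq_forall_mem_Icc_hasDerivWithinAt₀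
    exact ⟨α, hα0, fun t ht => (hα t (Ioo_subset_Icc_self ht)).hasDerivAt
      (Icc_mem_nhds ht.1 ht.2)⟩
  choose α hα0 hα using hloc
  have hagree : ∀ p q : ℕ, p ≤ q → ∀ s : ℝ, |s| < p → α p s = α q s := by
    intro p q hpq s hs
    have hp : (0 : ℝ) < p := (abs_nonneg s).trans_lt hs
    have hpq' : (p : ℝ) ≤ q := by exact_mod_cast hpq
    exact ODE_solution_unique_of_mem_Ioo (v := fun _ => v) (s := fun _ => univ) (K := C)
      (a := -(p : ℝ)) (b := p) (t₀ := 0)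
      (fun _ _ => hv.lipschitzOnWith) (by simpa using hp)
      (fun t ht => ⟨hα p t ht, mem_univ _⟩)
      (fun t ht => ⟨hα q t ⟨by linarith [ht.1], by linarith [ht.2]⟩, mem_univ _⟩)
      (by rw [hα0, hα0]) (abs_lt.1 hs)
  have hagree' : ∀ p q : ℕ, ∀ s : ℝ, |s| < p → |s| < q → α p s = α q s := by
    intro p q s hp hq
    rcases le_total p q with h | h
    · exact hagree p q h s hp
    · exact (hagree q p h s hq).symm
  -- The index is an integer strictly above `|t|`, so near `t` the glued curve agrees with one fixed
  -- local solution.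
  refine ⟨fun t => α (⌊|t|⌋₊ + 1) t, by simp [hα0], fun t => ?_⟩
  have ht : |t| < ((⌊|t|⌋₊ + 1 : ℕ) : ℝ) := by push_cast; exact Nat.lt_floor_add_one _
  refine (hα (⌊|t|⌋₊ + 1) t (abs_lt.1 ht)).congr_of_eventuallyEq ?_
  filter_upwards [(continuous_abs.tendsto t).eventually (gt_mem_nhds ht)] with s hs
  exact hagree' _ _ s (by push_cast; exact Nat.lt_floor_add_one _) hs

/-- A solution of an autonomous differential equation with smooth right-hand side is smooth. -/
theorem contDiff_of_forall_hasDerivAt {v : E → E} (hv : ContDiff ℝ ∞ v) {γ : ℝ → E}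
    (hγ : ∀ t, HasDerivAt γ (v (γ t)) t) : ContDiff ℝ ∞ γ := by
  rw [contDiff_infty]
  intro k
  induction k with
  | zero =>
    exact contDiff_zero.2 (continuous_iff_continuousAt.2 fun t => (hγ t).continuousAt)
  | succ k ih =>
    have h : deriv γ = v ∘ γ := funext fun t => (hγ t).deriv
    push_cast
    rw [contDiff_succ_iff_deriv]
    refine ⟨fun t => (hγ t).differentiableAt, by simp, ?_⟩
    rw [h]
    exact (hv.of_le (by exact_mod_cast le_top)).comp ih

/-- A compact subset of an open set in a finite-dimensional space has a smooth cutoff function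
that is supported in a compact subset of the open set. -/
theorem IsCompact.exists_contDiff_cutoff [FiniteDimensional ℝ E] {C S : Set E} (hC : IsCompact C)
    (hS : IsOpen S) (hCS : C ⊆ S) :
    ∃ (T : Set E) (χ : E → ℝ), IsCompact T ∧ T ⊆ S ∧ ContDiff ℝ ∞ χ ∧
      (∀ x ∈ C, χ x = 1) ∧ (∀ x ∉ T, χ x = 0) ∧ ∀ x, 0 ≤ χ x := by
  obtain ⟨T, hT, hCT, hTS⟩ := exists_compact_between hC hS hCS
  obtain ⟨χ, h0, h1, h01⟩ := exists_contMDiffMap_zero_one_of_isClosed (n := ⊤) 𝓘(ℝ, E)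
    (isOpen_interior (s := T)).isClosed_compl hC.isClosed
    (disjoint_left.2 fun x hx hxC => hx (hCT hxC))
  refine ⟨T, χ, hT, hTS, χ.contMDiff.contDiff, fun x hx => h1 hx,
    fun x hx => h0 fun hx' => hx (interior_subset hx'), fun x => (h01 x).1⟩

end Existence

/-! ### Gradient flows: global existence, uniqueness, exponential decay -/

variable {E : Type*} [NormedAddCommGroup E] [InnerProductSpace ℝ E] [FiniteDimensional ℝ E]
  {f : E → ℝ} {g : E → E} {S : Set E}

/-- The chain rule for a function along a curve, in terms of its gradient. -/
theorem HasGradientAt.hasDerivWithinAt_comp {γ : ℝ → E} {γ' w : E} {I : Set ℝ} {t : ℝ}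
    (hf : HasGradientAt f w (γ t)) (hγ : HasDerivWithinAt γ γ' I t) :
    HasDerivWithinAt (f ∘ γ) ⟪w, γ'⟫ I t := by
  simpa using hf.hasFDerivAt.comp_hasDerivWithinAt t hγ

/-- If `f` has a smooth gradient `g` on an open set and a compact sublevel set there, then the
gradient flow of `f` that starts on this level exists for all time, is smooth and unique. -/
theorem exists_gradientFlow_of_isCompact_sublevel (hS : IsOpen S) (hg : ContDiffOn ℝ ∞ g S)
    (hf : ∀ x ∈ S, HasGradientAt f (g x) x) {x₀ : E} (hx₀ : x₀ ∈ S)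
    (hC : IsCompact {x ∈ S | f x ≤ f x₀}) :
    ∃ γ : ℝ → E, γ 0 = x₀ ∧ ContDiff ℝ ∞ γ ∧
      (∀ t, 0 ≤ t → γ t ∈ S ∧ HasDerivAt γ (-g (γ t)) t) ∧
      ∀ (I : Set ℝ) (η : ℝ → E), I ⊆ Ici 0 → I.OrdConnected → 0 ∈ I → η 0 = x₀ →
        (∀ t ∈ I, η t ∈ S ∧ HasDerivWithinAt η (-g (η t)) I t) → EqOn η γ I := by
  obtain ⟨T, χ, hT, hTS, hχ, hχ1, hχ0, hχn⟩ := hC.exists_contDiff_cutoff hS (fun x hx => hx.1)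
  -- The field is cut off outside a compact neighbourhood of the sublevel set; it becomes globally
  -- smooth and Lipschitz, and is still `-g` on the sublevel set.
  set v : E → E := fun x => -(χ x • g x) with hv_def
  have hv : ContDiff ℝ ∞ v := by
    rw [contDiff_iff_contDiffAt]
    intro x
    by_cases hx : x ∈ S
    · exact (hχ.contDiffAt.smul (hg.contDiffAt (hS.mem_nhds hx))).neg
    · have : v =ᶠ[𝓝 x] fun _ => 0 := by
        filter_upwards [hT.isClosed.isOpen_compl.mem_nhds fun h => hx (hTS h)] with y hy
        simp [hv_def, hχ0 y hy]
      exact contDiffAt_const.congr_of_eventuallyEq this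
  have hv0 : ∀ x ∉ T, v x = 0 := fun x hx => by simp [hv_def, hχ0 x hx]
  have hvC : ∀ x ∈ S, f x ≤ f x₀ → v x = -g x := fun x hx hfx => by
    simp [hv_def, hχ1 x ⟨hx, hfx⟩]
  have hsupp : HasCompactSupport v := HasCompactSupport.intro hT hv0
  obtain ⟨L, hL⟩ := hv.lipschitzWith_of_hasCompactSupport hsupp (by simp)
  obtain ⟨b, hb⟩ := hsupp.exists_bound_of_continuous hv.continuous
  have hb0 : 0 ≤ b := (norm_nonneg _).trans (hb x₀)
  obtain ⟨γ, hγ0, hγ⟩ := exists_hasDerivAt_of_lipschitzWith_of_norm_le (b := ⟨b, hb0⟩) hL hb x₀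
  have hx₀T : x₀ ∈ T := by
    by_contra h
    have := hχ1 x₀ ⟨hx₀, le_rfl⟩
    rw [hχ0 x₀ h] at this
    exact zero_ne_one this
  -- Outside `T` the field vanishes, so a curve that is ever there is constant by uniqueness; but it
  -- passes through `x₀ ∈ T`.
  have hγT : ∀ t, γ t ∈ T := by
    intro t
    by_contra ht
    have := ODE_solution_unique_univ (v := fun _ => v) (s := fun _ => univ) (K := L)
      (f := γ) (g := fun _ => γ t) (t₀ := t) (fun _ => hL.lipschitzOnWith)
      (fun s => ⟨hγ s, mem_univ _⟩)
      (fun s => ⟨by rw [hv0 _ ht]; exact hasDerivAt_const _ _, mem_univ _⟩) rfl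
    have h0 := congrFun this 0
    simp only [hγ0] at h0
    exact ht (h0 ▸ hx₀T)
  -- Since `χ ≥ 0`, `f` still decreases along the cut-off flow; for `t ≥ 0` the curve therefore
  -- stays where `χ = 1`.
  have hanti : ∀ t, 0 ≤ t → f (γ t) ≤ f x₀ := by
    have hd : ∀ t, HasDerivAt (f ∘ γ) ⟪g (γ t), v (γ t)⟫ t := fun t => by
      rw [← hasDerivWithinAt_univ]
      exact (hf _ (hTS (hγT t))).hasDerivWithinAt_comp (hγ t).hasDerivWithinAt
    have hA : Antitone (f ∘ γ) := antitone_of_hasDerivAt_nonpos hd fun t => by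
      simp only [hv_def, inner_neg_right, inner_smul_right, real_inner_self_eq_norm_sq]
      have := hχn (γ t)
      simp only [Pi.zero_apply, neg_nonpos]
      positivity
    intro t ht
    simpa [hγ0] using hA ht
  refine ⟨γ, hγ0, contDiff_of_forall_hasDerivAt hv hγ, fun t ht => ⟨hTS (hγT t), ?_⟩, ?_⟩
  · rw [← hvC _ (hTS (hγT t)) (hanti t ht)]
    exact hγ t
  intro I η hI hIc h0I hη0 hη t ht
  have ht0 : 0 ≤ t := hI ht
  have hIcc : Icc 0 t ⊆ I := hIc.out h0I ht
  have hcont : ContinuousOn η (Icc 0 t) := fun s hs =>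
    ((hη s (hIcc hs)).2.continuousWithinAt).mono hIcc
  -- A competing solution also decreases `f`, so it never meets the region where the field was
  -- altered, and Lipschitz uniqueness applies to it.
  have hηle : ∀ s ∈ Icc 0 t, f (η s) ≤ f x₀ := by
    have hA : AntitoneOn (f ∘ η) (Icc 0 t) := by
      refine antitoneOn_of_hasDerivWithinAt_nonpos (f' := fun s => ⟪g (η s), -g (η s)⟫)
        (convex_Icc 0 t) ?_ ?_ ?_
      · intro s hs
        exact ((hf _ (hη s (hIcc hs)).1).hasDerivWithinAt_comp
          ((hη s (hIcc hs)).2.mono hIcc)).continuousWithinAt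
      · intro s hs
        have hs' : s ∈ Icc 0 t := interior_subset hs
        exact (hf _ (hη s (hIcc hs')).1).hasDerivWithinAt_comp
          ((hη s (hIcc hs')).2.mono (interior_subset.trans hIcc))
      · intro s _
        simp only [inner_neg_right, real_inner_self_eq_norm_sq, neg_nonpos]
        positivity
    intro s hs
    simpa [hη0] using hA (left_mem_Icc.2 ht0) hs hs.1
  refine ODE_solution_unique_of_mem_Icc_right (v := fun _ => v) (s := fun _ => univ) (K := L)
    (a := 0) (b := t) (fun _ _ => hL.lipschitzOnWith) hcont (fun s hs => ?_)
    (fun _ _ => mem_univ _) (fun s _ => (hγ s).continuousAt.continuousWithinAt)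
    (fun s _ => (hγ s).hasDerivWithinAt) (fun _ _ => mem_univ _) (by rw [hη0, hγ0])
    (right_mem_Icc.2 ht0)
  have hs' : s ∈ Icc 0 t := Ico_subset_Icc_self hs
  change HasDerivWithinAt η (v (η s)) (Ici s) s
  rw [hvC _ (hη s (hIcc hs')).1 (hηle s hs')]
  refine ((hη s (hIcc hs')).2.mono ((Icc_subset_Icc_left hs.1).trans hIcc)).mono_of_mem_nhdsWithin
    (Icc_mem_nhdsGE hs.2)

/-- Under a Polyak-Łojasiewicz inequality the function value decays exponentially along the
gradient flow. -/
theorem exp_decay_of_gradient_dominated (hf : ∀ x ∈ S, HasGradientAt f (g x) x) {m α : ℝ}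
    (hdom : ∀ x ∈ S, α * (f x - m) ≤ ‖g x‖ ^ 2) {γ : ℝ → E}
    (hγ : ∀ t, 0 ≤ t → γ t ∈ S ∧ HasDerivAt γ (-g (γ t)) t) {t : ℝ} (ht : 0 ≤ t) :
    f (γ t) - m ≤ Real.exp (-α * t) * (f (γ 0) - m) := by
  have hd : ∀ s, 0 ≤ s → HasDerivAt (fun s => Real.exp (α * s) * (f (γ s) - m))
      (Real.exp (α * s) * α * (f (γ s) - m) + Real.exp (α * s) * ⟪g (γ s), -g (γ s)⟫) s := by
    intro s hs
    have h1 : HasDerivAt (fun s => f (γ s)) ⟪g (γ s), -g (γ s)⟫ s := by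
      rw [← hasDerivWithinAt_univ]
      exact (hf _ (hγ s hs).1).hasDerivWithinAt_comp (hγ s hs).2.hasDerivWithinAt
    have h2 : HasDerivAt (fun s => Real.exp (α * s)) (Real.exp (α * s) * α) s := by
      simpa using ((hasDerivAt_id s).const_mul α).exp
    exact h2.mul (h1.sub_const m)
  -- The derivative is `exp (α s) * (α (f - m) - ‖g‖²)`, which is nonpositive by `hdom`.
  have hA : AntitoneOn (fun s => Real.exp (α * s) * (f (γ s) - m)) (Ici 0) := by
    refine antitoneOn_of_hasDerivWithinAt_nonpos (convex_Ici 0)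
      (fun s hs => (hd s hs).continuousAt.continuousWithinAt)
      (fun s hs => (hd s (interior_subset hs)).hasDerivWithinAt) fun s hs => ?_
    have h := hdom _ (hγ s (interior_subset hs)).1
    rw [inner_neg_right, real_inner_self_eq_norm_sq]
    nlinarith [Real.exp_pos (α * s)]
  have h := hA (mem_Ici.2 le_rfl) (mem_Ici.2 ht) ht
  simp only [mul_zero, Real.exp_zero, one_mul] at h
  calc f (γ t) - m = Real.exp (-α * t) * (Real.exp (α * t) * (f (γ t) - m)) := by
        rw [← mul_assoc, ← Real.exp_add]; simp
    _ ≤ _ := by gcongr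

end GradientFlow

/-! ### Trace inequalities and spectral bounds for semidefinite matrices -/

section MatrixInequalities

namespace Matrix

variable {ι κ : Type*} [Fintype ι] [Fintype κ]

open scoped MatrixOrder Matrix.Norms.L2Operator in
/-- The trace of a product of two positive semidefinite matrices is nonnegative. -/
theorem PosSemidef.trace_mul_nonneg {P Y : Matrix ι ι ℝ} (hP : P.PosSemidef) (hY : Y.PosSemidef) :
    0 ≤ (P * Y).trace := by
  classical
  obtain ⟨C, rfl⟩ := CStarAlgebra.nonneg_iff_eq_star_mul_self.mp hP.nonneg
  rw [Matrix.mul_assoc, Matrix.trace_mul_comm]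
  exact (hY.mul_mul_conjTranspose_same C).trace_nonneg

theorem PosSemidef.trace_mul_le_trace_mul {P P' Y : Matrix ι ι ℝ} (h : (P' - P).PosSemidef)
    (hY : Y.PosSemidef) : (P * Y).trace ≤ (P' * Y).trace := by
  have := h.trace_mul_nonneg hY
  rw [Matrix.sub_mul, Matrix.trace_sub] at this
  linarith

theorem PosSemidef.mul_mul_transpose_same {Y : Matrix ι ι ℝ} (hY : Y.PosSemidef)
    (D : Matrix κ ι ℝ) : (D * Y * Dᵀ).PosSemidef := by
  simpa [conjTranspose_eq_transpose_of_trivial] using hY.mul_mul_conjTranspose_same D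

theorem PosSemidef.transpose_mul_mul_same {Y : Matrix ι ι ℝ} (hY : Y.PosSemidef)
    (D : Matrix ι κ ℝ) : (Dᵀ * Y * D).PosSemidef := by
  simpa [conjTranspose_eq_transpose_of_trivial] using hY.conjTranspose_mul_mul_same D

theorem PosSemidef.transpose_eq {ν : Type*} {Y : Matrix ν ν ℝ} (hY : Y.PosSemidef) : Yᵀ = Y := by
  simpa [conjTranspose_eq_transpose_of_trivial] using hY.isHermitian.eq

variable [DecidableEq ι]

/-- A lower bound of the eigenvalues is a lower bound of the matrix. -/
theorem IsHermitian.posSemidef_sub_smul_one {N : Matrix ι ι ℝ} (hN : N.IsHermitian) {c : ℝ}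
    (hc : ∀ i, c ≤ hN.eigenvalues i) : (N - c • (1 : Matrix ι ι ℝ)).PosSemidef := by
  have h1 : c • (1 : Matrix ι ι ℝ) = Unitary.conjStarAlgAut ℝ _ hN.eigenvectorUnitary
      (c • (1 : Matrix ι ι ℝ)) := by
    simp
  have h2 : N - c • (1 : Matrix ι ι ℝ) = Unitary.conjStarAlgAut ℝ _ hN.eigenvectorUnitary
      (diagonal (fun i => hN.eigenvalues i - c)) := by
    conv_lhs => rw [hN.spectral_theorem, h1, ← map_sub]
    congr 1
    ext i j
    by_cases h : i = j
    · subst h; simp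
    · simp [h]
  rw [h2, Unitary.conjStarAlgAut_apply]
  exact (PosSemidef.diagonal fun i => sub_nonneg.2 (hc i)).mul_mul_conjTranspose_same _

/-- A positive definite matrix is bounded below by a positive multiple of the identity. -/
theorem PosDef.exists_posSemidef_sub_smul_one {N : Matrix ι ι ℝ} (hN : N.PosDef) :
    ∃ c : ℝ, 0 < c ∧ (N - c • (1 : Matrix ι ι ℝ)).PosSemidef := by
  -- Taking any sufficiently small `c`, not the least eigenvalue, also covers an empty index type.
  have h : ∀ᶠ c in nhdsWithin (0 : ℝ) (Ioi 0), 0 < c ∧ ∀ i, c ≤ hN.isHermitian.eigenvalues i :=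
    (eventually_mem_nhdsWithin (a := (0 : ℝ)) (s := Ioi 0)).and (Filter.eventually_all.2 fun i =>
      Filter.mem_of_superset (Ioc_mem_nhdsGT (hN.eigenvalues_pos i)) fun _ h => h.2)
  obtain ⟨c, hc, hi⟩ := h.exists
  exact ⟨c, hc, hN.isHermitian.posSemidef_sub_smul_one hi⟩

/-- A symmetric matrix is bounded above by a positive multiple of the identity. -/
theorem IsHermitian.exists_posSemidef_smul_one_sub {N : Matrix ι ι ℝ} (hN : N.IsHermitian) :
    ∃ c : ℝ, 0 < c ∧ (c • (1 : Matrix ι ι ℝ) - N).PosSemidef := by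
  have h : ∀ᶠ c in Filter.atTop, (0 : ℝ) < c ∧ ∀ i, -c ≤ hN.neg.eigenvalues i :=
    (Filter.eventually_gt_atTop 0).and (Filter.eventually_all.2 fun i =>
      (Filter.eventually_ge_atTop (-hN.neg.eigenvalues i)).mono fun _ h => by linarith)
  obtain ⟨c, hc, hi⟩ := h.exists
  refine ⟨c, hc, ?_⟩
  have := hN.neg.posSemidef_sub_smul_one hi
  rwa [neg_smul, sub_neg_eq_add, neg_add_eq_sub] at this

end Matrix

end MatrixInequalities

/-! ### Calculus with the Frobenius norm -/

section FrobeniusCalculus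

variable {m n p : ℕ}

theorem frobenius_inner_eq_trace (E F : Matrix (Fin m) (Fin n) ℝ) :
    inner ℝ E F = (Eᵀ * F).trace := rfl

theorem frobenius_norm_sq_eq_trace (E : Matrix (Fin m) (Fin n) ℝ) :
    ‖E‖ ^ 2 = (Eᵀ * E).trace := by
  rw [← real_inner_self_eq_norm_sq, frobenius_inner_eq_trace]

theorem frobenius_norm_sq_eq_trace_mul_transpose (E : Matrix (Fin m) (Fin n) ℝ) :
    ‖E‖ ^ 2 = (E * Eᵀ).trace := by
  rw [frobenius_norm_sq_eq_trace, Matrix.trace_mul_comm]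

theorem isBoundedBilinearMap_matrix_mul : IsBoundedBilinearMap ℝ
    fun P : Matrix (Fin m) (Fin n) ℝ × Matrix (Fin n) (Fin p) ℝ => P.1 * P.2 where
  add_left _ _ _ := Matrix.add_mul _ _ _
  smul_left _ _ _ := Matrix.smul_mul _ _ _
  add_right _ _ _ := Matrix.mul_add _ _ _
  smul_right _ _ _ := Matrix.mul_smul _ _ _
  bound := ⟨1, one_pos, fun P Q => by
    rw [one_mul]
    exact Matrix.frobenius_norm_mul P Q⟩

theorem ContDiffAt.matrix_mul {E : Type*} [NormedAddCommGroup E] [NormedSpace ℝ E] {k : ℕ∞ω}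
    {F : E → Matrix (Fin m) (Fin n) ℝ} {G : E → Matrix (Fin n) (Fin p) ℝ} {x : E}
    (hF : ContDiffAt ℝ k F x) (hG : ContDiffAt ℝ k G x) :
    ContDiffAt ℝ k (fun y => F y * G y) x :=
  isBoundedBilinearMap_matrix_mul.contDiff.comp_contDiffAt x (hF.prodMk hG)

theorem ContDiffAt.matrix_transpose {E : Type*} [NormedAddCommGroup E] [NormedSpace ℝ E] {k : ℕ∞ω}
    {F : E → Matrix (Fin m) (Fin n) ℝ} {x : E} (hF : ContDiffAt ℝ k F x) :
    ContDiffAt ℝ k (fun y => (F y)ᵀ) x :=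
  (LinearMap.toContinuousLinearMap
    (Matrix.transposeLinearEquiv (Fin m) (Fin n) ℝ ℝ).toLinearMap).contDiff.comp_contDiffAt x hF

end FrobeniusCalculus

/-! ### The Stein equation in a Banach algebra -/

section Stein

variable {𝔸 : Type*} [NormedRing 𝔸] [NormedAlgebra ℝ 𝔸]

/-- The solution `y` of the Stein equation `y = w + a y b` in a normed algebra. -/
noncomputable def steinSolution (a b w : 𝔸) : 𝔸 :=
  Ring.inverse (1 - ContinuousLinearMap.mulLeftRight ℝ 𝔸 a b) w

theorem mulLeftRight_pow (a b : 𝔸) (k : ℕ) :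
    ContinuousLinearMap.mulLeftRight ℝ 𝔸 a b ^ k =
      ContinuousLinearMap.mulLeftRight ℝ 𝔸 (a ^ k) (b ^ k) := by
  induction k with
  | zero => ext1 w; simp
  | succ k ih =>
    ext1 w
    rw [pow_succ', ih]
    change a * (a ^ k * w * b ^ k) * b = a ^ (k + 1) * w * b ^ (k + 1)
    rw [pow_succ' a, pow_succ b]
    simp only [mul_assoc]

variable [CompleteSpace 𝔸] {a b : 𝔸}

theorem summable_mulLeftRight_pow (h : Summable fun k : ℕ => ‖a ^ k‖ * ‖b ^ k‖) :
    Summable fun k : ℕ => ContinuousLinearMap.mulLeftRight ℝ 𝔸 a b ^ k := by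
  refine Summable.of_norm_bounded h fun k => ?_
  rw [mulLeftRight_pow]
  exact ContinuousLinearMap.opNorm_mulLeftRight_apply_apply_le ℝ _ _ _

/-- The operator `y ↦ y - a y b` as a unit with inverse `∑ₖ aᵏ y bᵏ`. -/
noncomputable def steinUnit (h : Summable fun k : ℕ => ‖a ^ k‖ * ‖b ^ k‖) : (𝔸 →L[ℝ] 𝔸)ˣ :=
  ⟨1 - ContinuousLinearMap.mulLeftRight ℝ 𝔸 a b,
    ∑' k : ℕ, ContinuousLinearMap.mulLeftRight ℝ 𝔸 a b ^ k,
    (summable_mulLeftRight_pow h).one_sub_mul_tsum_pow,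
    (summable_mulLeftRight_pow h).tsum_pow_mul_one_sub⟩

theorem hasSum_steinSolution (h : Summable fun k : ℕ => ‖a ^ k‖ * ‖b ^ k‖) (w : 𝔸) :
    HasSum (fun k : ℕ => a ^ k * w * b ^ k) (steinSolution a b w) := by
  have h1 : steinSolution a b w = (∑' k : ℕ, ContinuousLinearMap.mulLeftRight ℝ 𝔸 a b ^ k) w := by
    change Ring.inverse (steinUnit h : 𝔸 →L[ℝ] 𝔸) w = _
    rw [Ring.inverse_unit]
    rfl
  rw [h1]
  have h2 := (ContinuousLinearMap.apply ℝ 𝔸 w).hasSum (summable_mulLeftRight_pow h).hasSum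
  simp only [mulLeftRight_pow] at h2 ⊢
  exact h2

theorem steinSolution_eq (h : Summable fun k : ℕ => ‖a ^ k‖ * ‖b ^ k‖) (w : 𝔸) :
    steinSolution a b w = w + a * steinSolution a b w * b := by
  have h1 : ((steinUnit h : 𝔸 →L[ℝ] 𝔸) * Ring.inverse (steinUnit h : 𝔸 →L[ℝ] 𝔸)) w = w := by
    rw [Ring.inverse_unit, Units.mul_inv]
    rfl
  have h2 : steinSolution a b w - a * steinSolution a b w * b = w := h1
  exact sub_eq_iff_eq_add.1 h2

/-- Inversion is smooth at every unit of the Banach algebra of operators, so convergence of the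
series at the single point `x` suffices. -/
theorem contDiffAt_steinSolution {E : Type*} [NormedAddCommGroup E] [NormedSpace ℝ E] {k : ℕ∞ω}
    {F G H : E → 𝔸} {x : E} (hF : ContDiffAt ℝ k F x) (hG : ContDiffAt ℝ k G x)
    (hH : ContDiffAt ℝ k H x) (h : Summable fun k : ℕ => ‖F x ^ k‖ * ‖G x ^ k‖) :
    ContDiffAt ℝ k (fun y => steinSolution (F y) (G y) (H y)) x := by
  have h1 : ContDiffAt ℝ k (fun y => ContinuousLinearMap.mulLeftRight ℝ 𝔸 (F y) (G y)) x :=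
    (ContDiffAt.comp x (g := ContinuousLinearMap.mulLeftRight ℝ 𝔸) (f := F)
      (ContinuousLinearMap.contDiff _).contDiffAt hF).clm_apply hG
  have h2 : ContDiffAt ℝ k
      (fun y => Ring.inverse (1 - ContinuousLinearMap.mulLeftRight ℝ 𝔸 (F y) (G y))) x :=
    ContDiffAt.comp x (g := Ring.inverse)
      (f := fun y => 1 - ContinuousLinearMap.mulLeftRight ℝ 𝔸 (F y) (G y))
      (contDiffAt_ringInverse ℝ (steinUnit h)) (contDiffAt_const.sub h1)
  exact h2.clm_apply hH

end Stein

/-! ### Schur stability and the discrete Lyapunov equation -/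

section Lyapunov

open Filter Asymptotics
open scoped Topology

attribute [local instance] Matrix.frobeniusNormedRing Matrix.frobeniusNormedAlgebra

namespace LQR

variable {n : ℕ} {M : Matrix (Fin n) (Fin n) ℝ}

/-- A matrix is Schur stable if all its complex eigenvalues lie in the open unit disk. -/
def IsSchur (M : Matrix (Fin n) (Fin n) ℝ) : Prop :=
  spectralRadius ℂ (M.map (algebraMap ℝ ℂ)) < 1

theorem IsSchur.exists_norm_pow_isBigO (hM : IsSchur M) :
    ∃ r : ℝ, 0 ≤ r ∧ r < 1 ∧ (fun k : ℕ => M ^ k) =O[atTop] fun k => r ^ k := by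
  obtain ⟨r, hr0, hr1, h⟩ := pow_apply_isBigO M hM
  refine ⟨r, hr0, hr1, ?_⟩
  have : (fun k : ℕ => M ^ k) = fun k => ∑ i, ∑ j, (M ^ k) i j • Matrix.single i j (1 : ℝ) := by
    funext k
    conv_lhs => rw [Matrix.matrix_eq_sum_single (M ^ k)]
    simp
  rw [this]
  refine IsBigO.fun_sum fun i _ => IsBigO.fun_sum fun j _ => ?_
  have := (h i j).smul (isBigO_refl (fun _ : ℕ => Matrix.single i j (1 : ℝ)) atTop)
  refine this.trans (IsBigO.of_bound ‖Matrix.single i j (1 : ℝ)‖ (Eventually.of_forall fun k => ?_))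
  rw [norm_smul, mul_comm]

theorem IsSchur.summable_norm_pow_sq (hM : IsSchur M) : Summable fun k : ℕ => ‖M ^ k‖ ^ 2 := by
  obtain ⟨r, hr0, hr1, h⟩ := hM.exists_norm_pow_isBigO
  have h2 : (fun k : ℕ => ‖M ^ k‖ ^ 2) =O[atTop] fun k => (r ^ 2) ^ k := by
    have := h.norm_left.pow 2
    simpa only [← pow_mul, mul_comm] using this
  exact summable_of_isBigO_nat (summable_geometric_of_lt_one (by positivity) (by nlinarith)) h2

/-- The spectral radius is at most `(‖M ^ (k+1)‖ * ‖1‖) ^ (1/(k+1))`; the factor `‖1‖` remains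
because the Frobenius norm of the identity is √n. A single power certifies stability, which makes
stability an open condition. -/
theorem isSchur_of_norm_pow_lt {k : ℕ}
    (h : ‖M ^ (k + 1)‖ * ‖(1 : Matrix (Fin n) (Fin n) ℝ)‖ < 1) : IsSchur M := by
  have hn : ∀ N : Matrix (Fin n) (Fin n) ℝ, ‖N.map (algebraMap ℝ ℂ)‖ = ‖N‖ := fun N =>
    Matrix.frobenius_norm_map_eq _ _ (by intro a; simp)
  have h1 := spectrum.spectralRadius_le_pow_nnnorm_pow_one_div ℂ (M.map (algebraMap ℝ ℂ)) k
  have h3 : (M.map (algebraMap ℝ ℂ)) ^ (k + 1) = (M ^ (k + 1)).map (algebraMap ℝ ℂ) :=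
    (map_pow (algebraMap ℝ ℂ).mapMatrix M (k + 1)).symm
  have h4 : (1 : Matrix (Fin n) (Fin n) ℂ) = (1 : Matrix (Fin n) (Fin n) ℝ).map (algebraMap ℝ ℂ) :=
    (map_one (algebraMap ℝ ℂ).mapMatrix).symm
  refine h1.trans_lt ?_
  rw [← ENNReal.mul_rpow_of_nonneg _ _ (by positivity)]
  refine ENNReal.rpow_lt_one ?_ (by positivity)
  rw [h3, h4]
  have : ‖(M ^ (k + 1)).map (algebraMap ℝ ℂ)‖₊ * ‖(1 : Matrix (Fin n) (Fin n) ℝ).map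
      (algebraMap ℝ ℂ)‖₊ < 1 := by
    rw [← NNReal.coe_lt_coe]
    push_cast
    rw [hn, hn]
    exact h
  exact_mod_cast this

theorem isSchur_of_tendsto (h : Tendsto (fun k : ℕ => M ^ k) atTop (𝓝 0)) : IsSchur M := by
  have h1 : Tendsto (fun k : ℕ => ‖M ^ (k + 1)‖ * ‖(1 : Matrix (Fin n) (Fin n) ℝ)‖) atTop (𝓝 0) := by
    simpa using ((h.comp (tendsto_add_atTop_nat 1)).norm).mul_const
      ‖(1 : Matrix (Fin n) (Fin n) ℝ)‖
  obtain ⟨k, hk⟩ := (h1.eventually (gt_mem_nhds one_pos)).exists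
  exact isSchur_of_norm_pow_lt hk

theorem IsSchur.tendsto_pow (hM : IsSchur M) : Tendsto (fun k : ℕ => M ^ k) atTop (𝓝 0) := by
  obtain ⟨r, hr0, hr1, h⟩ := hM.exists_norm_pow_isBigO
  exact h.trans_tendsto (tendsto_pow_atTop_nhds_zero_of_lt_one hr0 hr1)

/-- Each partial sum is continuous in `M`, so this criterion is closed; it keeps sublevel sets of
the cost away from the boundary of the stabilizing gains. -/
theorem isSchur_of_sum_norm_pow_sq_le {b : ℝ}
    (h : ∀ N : ℕ, ∑ k ∈ Finset.range N, ‖M ^ k‖ ^ 2 ≤ b) : IsSchur M := by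
  have hs : Summable fun k : ℕ => ‖M ^ k‖ ^ 2 :=
    summable_of_sum_range_le (fun _ => by positivity) h
  refine isSchur_of_tendsto (tendsto_zero_iff_norm_tendsto_zero.2 ?_)
  have := hs.tendsto_atTop_zero.sqrt
  simpa [Real.sqrt_sq] using this

theorem isOpen_isSchur : IsOpen {M : Matrix (Fin n) (Fin n) ℝ | IsSchur M} := by
  rw [isOpen_iff_mem_nhds]
  intro M hM
  have h1 : Tendsto (fun k : ℕ => ‖M ^ (k + 1)‖ * ‖(1 : Matrix (Fin n) (Fin n) ℝ)‖) atTop (𝓝 0) := by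
    simpa using ((hM.tendsto_pow.comp (tendsto_add_atTop_nat 1)).norm).mul_const
      ‖(1 : Matrix (Fin n) (Fin n) ℝ)‖
  obtain ⟨k, hk⟩ := (h1.eventually (gt_mem_nhds one_pos)).exists
  have hc : Continuous fun N : Matrix (Fin n) (Fin n) ℝ =>
      ‖N ^ (k + 1)‖ * ‖(1 : Matrix (Fin n) (Fin n) ℝ)‖ := by fun_prop
  filter_upwards [(hc.tendsto M).eventually (gt_mem_nhds hk)] with N hN
  exact isSchur_of_norm_pow_lt hN

theorem IsSchur.transpose (hM : IsSchur M) : IsSchur Mᵀ := by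
  refine isSchur_of_tendsto (tendsto_zero_iff_norm_tendsto_zero.2 ?_)
  simpa [← Matrix.transpose_pow] using hM.tendsto_pow.norm

/-- The solution `Y` of the discrete Lyapunov equation `Y = W + M Y Mᵀ`. -/
noncomputable def lyapunov (M W : Matrix (Fin n) (Fin n) ℝ) : Matrix (Fin n) (Fin n) ℝ :=
  steinSolution M Mᵀ W

theorem IsSchur.summable_norm_pow_mul (hM : IsSchur M) :
    Summable fun k : ℕ => ‖M ^ k‖ * ‖Mᵀ ^ k‖ := by
  simpa [← Matrix.transpose_pow, ← sq] using hM.summable_norm_pow_sq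

theorem IsSchur.hasSum_lyapunov (hM : IsSchur M) (W : Matrix (Fin n) (Fin n) ℝ) :
    HasSum (fun k : ℕ => M ^ k * W * (M ^ k)ᵀ) (lyapunov M W) := by
  have h := hasSum_steinSolution hM.summable_norm_pow_mul W
  simp only [← Matrix.transpose_pow] at h
  exact h

theorem IsSchur.lyapunov_eq (hM : IsSchur M) (W : Matrix (Fin n) (Fin n) ℝ) :
    lyapunov M W = W + M * lyapunov M W * Mᵀ :=
  steinSolution_eq hM.summable_norm_pow_mul W

theorem hasSum_trace {z : ℕ → Matrix (Fin n) (Fin n) ℝ} {Z : Matrix (Fin n) (Fin n) ℝ}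
    (V : Matrix (Fin n) (Fin n) ℝ) (h : HasSum z Z) :
    HasSum (fun k => (V * z k).trace) (V * Z).trace :=
  (LinearMap.toContinuousLinearMap ((Matrix.traceLinearMap (Fin n) ℝ ℝ).comp
    (LinearMap.mulLeft ℝ V))).hasSum h

/-- Both sides are `∑ₖ Tr (V Mᵏ W (Mᵏ)ᵀ)`: the solution operators for `M` and `Mᵀ` are adjoint in
the trace pairing. -/
theorem IsSchur.trace_mul_lyapunov (hM : IsSchur M) (V W : Matrix (Fin n) (Fin n) ℝ) :
    (V * lyapunov M W).trace = (lyapunov Mᵀ V * W).trace := by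
  have h1 := hasSum_trace V (hM.hasSum_lyapunov W)
  have h2 := hasSum_trace W (hM.transpose.hasSum_lyapunov V)
  rw [Matrix.trace_mul_comm (lyapunov Mᵀ V)]
  refine h1.unique ?_
  convert h2 using 2 with k
  rw [← Matrix.transpose_pow, Matrix.transpose_transpose, Matrix.trace_mul_comm W,
    Matrix.mul_assoc ((M ^ k)ᵀ * V), Matrix.trace_mul_comm _ (M ^ k * W), Matrix.trace_mul_comm V]
  simp only [Matrix.mul_assoc]

theorem IsSchur.posSemidef_lyapunov (hM : IsSchur M) {W : Matrix (Fin n) (Fin n) ℝ}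
    (hW : W.PosSemidef) : (lyapunov M W).PosSemidef := by
  have hs := hM.hasSum_lyapunov W
  have hk : ∀ k : ℕ, (M ^ k * W * (M ^ k)ᵀ).PosSemidef := fun k => hW.mul_mul_transpose_same _
  refine Matrix.PosSemidef.of_dotProduct_mulVec_nonneg ?_ fun y => ?_
  · have h2 := (LinearMap.toContinuousLinearMap
      (Matrix.transposeLinearEquiv (Fin n) (Fin n) ℝ ℝ).toLinearMap).hasSum hs
    have h3 : HasSum (fun k : ℕ => M ^ k * W * (M ^ k)ᵀ) (lyapunov M W)ᵀ := by
      have h4 : (fun k : ℕ => M ^ k * W * (M ^ k)ᵀ) = fun k => (M ^ k * W * (M ^ k)ᵀ)ᵀ :=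
        funext fun k => (hk k).transpose_eq.symm
      rw [h4]
      exact h2
    rw [Matrix.IsHermitian, Matrix.conjTranspose_eq_transpose_of_trivial]
    exact h3.unique hs
  · have h2 := hasSum_trace (Matrix.vecMulVec y y) hs
    have h3 : ∀ Z : Matrix (Fin n) (Fin n) ℝ,
        (Matrix.vecMulVec y y * Z).trace = star y ⬝ᵥ Z *ᵥ y := fun Z => by
      rw [Matrix.vecMulVec_mul, Matrix.trace_vecMulVec, star_trivial, dotProduct_comm,
        Matrix.dotProduct_mulVec]
    rw [← h3]
    exact h2.nonneg fun k => by
      rw [h3]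
      exact (hk k).dotProduct_mulVec_nonneg y

theorem contDiffAt_lyapunov {E : Type*} [NormedAddCommGroup E] [NormedSpace ℝ E] {k : ℕ∞ω}
    {F G : E → Matrix (Fin n) (Fin n) ℝ} {x : E} (hF : ContDiffAt ℝ k F x)
    (hG : ContDiffAt ℝ k G x) (hx : IsSchur (F x)) :
    ContDiffAt ℝ k (fun y => lyapunov (F y) (G y)) x :=
  contDiffAt_steinSolution hF hF.matrix_transpose hG hx.summable_norm_pow_mul

end LQR

end Lyapunov

/-! ### The cost: exact expansion, gradient, gradient dominance, quadratic growth -/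

section QuadraticCost

open Filter Asymptotics
open scoped Topology

namespace LQR

variable {m n : ℕ} (A : Matrix (Fin n) (Fin n) ℝ) (B : Matrix (Fin n) (Fin m) ℝ)
  (Q : Matrix (Fin n) (Fin n) ℝ) (R : Matrix (Fin m) (Fin m) ℝ) (x : Fin n → Fin n → ℝ)

/-- The Gram matrix `∑ⱼ xⱼ xⱼᵀ` of the initial states. -/
def initialGram : Matrix (Fin n) (Fin n) ℝ := (Matrix.of x)ᵀ * Matrix.of x

/-- The Gram matrix of the trajectories of the closed loop with gain `K`. -/
noncomputable def stateGram (K : Matrix (Fin m) (Fin n) ℝ) : Matrix (Fin n) (Fin n) ℝ :=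
  lyapunov (A - B * K) (initialGram x)

/-- The matrix of the quadratic form that gives the cost of the gain `K`. -/
noncomputable def valueMatrix (K : Matrix (Fin m) (Fin n) ℝ) : Matrix (Fin n) (Fin n) ℝ :=
  lyapunov (A - B * K)ᵀ (Q + Kᵀ * R * K)

/-- The weight of a deviation of the input from that of the gain `K`. -/
noncomputable def inputWeight (K : Matrix (Fin m) (Fin n) ℝ) : Matrix (Fin m) (Fin m) ℝ :=
  R + Bᵀ * valueMatrix A B Q R K * B

/-- The first-order term of the cost at the gain `K`. -/
noncomputable def residual (K : Matrix (Fin m) (Fin n) ℝ) : Matrix (Fin m) (Fin n) ℝ :=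
  R * K - Bᵀ * valueMatrix A B Q R K * (A - B * K)

/-- The gradient of the cost. -/
noncomputable def costGradient (K : Matrix (Fin m) (Fin n) ℝ) : Matrix (Fin m) (Fin n) ℝ :=
  (2 : ℝ) • (residual A B Q R K * stateGram A B x K)

variable {A B Q R x} {K K' : Matrix (Fin m) (Fin n) ℝ}

theorem isSchur_of_mem (hK : K ∈ stabilizing A B) : IsSchur (A - B * K) := hK

theorem isOpen_stabilizing : IsOpen (stabilizing A B) := by
  have hc : Continuous fun K : Matrix (Fin m) (Fin n) ℝ => A - B * K := by fun_prop
  exact isOpen_isSchur.preimage hc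

theorem posSemidef_initialGram : (initialGram x).PosSemidef := by
  simpa [initialGram, Matrix.conjTranspose_eq_transpose_of_trivial] using
    Matrix.posSemidef_conjTranspose_mul_self (Matrix.of x)

/-- This is where linear independence of the initial states enters; it provides the bound σ > 0 used
below. -/
theorem posDef_initialGram (hx : LinearIndependent ℝ x) : (initialGram x).PosDef := by
  have hu : IsUnit (Matrix.of x) := Matrix.linearIndependent_rows_iff_isUnit.1 hx
  simpa [initialGram, Matrix.conjTranspose_eq_transpose_of_trivial] using
    Matrix.PosDef.conjTranspose_mul_self (Matrix.of x) (Matrix.mulVec_injective_of_isUnit hu)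

theorem stateGram_eq (hK : K ∈ stabilizing A B) :
    stateGram A B x K = initialGram x + (A - B * K) * stateGram A B x K * (A - B * K)ᵀ :=
  (isSchur_of_mem hK).lyapunov_eq _

theorem valueMatrix_eq (hK : K ∈ stabilizing A B) :
    valueMatrix A B Q R K =
      Q + Kᵀ * R * K + (A - B * K)ᵀ * valueMatrix A B Q R K * (A - B * K) := by
  have h := (isSchur_of_mem hK).transpose.lyapunov_eq (Q + Kᵀ * R * K)
  rwa [Matrix.transpose_transpose] at h

theorem posSemidef_stateGram (hK : K ∈ stabilizing A B) : (stateGram A B x K).PosSemidef :=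
  (isSchur_of_mem hK).posSemidef_lyapunov posSemidef_initialGram

/-- The difference is `M Y Mᵀ`. It makes any lower bound of the initial Gram matrix a lower bound of
all state Gram matrices, uniformly in the gain. -/
theorem posSemidef_stateGram_sub_initialGram (hK : K ∈ stabilizing A B) :
    (stateGram A B x K - initialGram x).PosSemidef := by
  have h := (posSemidef_stateGram (x := x) hK).mul_mul_transpose_same (A - B * K)
  rwa [eq_sub_of_add_eq' (stateGram_eq (x := x) hK).symm] at h

theorem posSemidef_valueMatrix (hQ : Q.PosSemidef) (hR : R.PosSemidef) (hK : K ∈ stabilizing A B) :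
    (valueMatrix A B Q R K).PosSemidef :=
  (isSchur_of_mem hK).transpose.posSemidef_lyapunov (hQ.add (hR.transpose_mul_mul_same K))

theorem posSemidef_inputWeight_sub (hQ : Q.PosSemidef) (hR : R.PosSemidef)
    (hK : K ∈ stabilizing A B) : (inputWeight A B Q R K - R).PosSemidef := by
  rw [inputWeight, add_sub_cancel_left]
  exact (posSemidef_valueMatrix hQ hR hK).transpose_mul_mul_same B

theorem initialGram_eq_sum : initialGram x = ∑ j, Matrix.vecMulVec (x j) (x j) := by
  ext a b
  simp [initialGram, Matrix.mul_apply, Matrix.sum_apply, Matrix.vecMulVec_apply]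

theorem stageCost_eq_trace (z : Fin n → ℝ) (K : Matrix (Fin m) (Fin n) ℝ) (k : ℕ) :
    stageCost A B Q R z K k = ((Q + Kᵀ * R * K) *
      ((A - B * K) ^ k * Matrix.vecMulVec z z * ((A - B * K) ^ k)ᵀ)).trace := by
  rw [Matrix.mul_vecMulVec, Matrix.vecMulVec_mul, Matrix.vecMul_transpose, Matrix.mul_vecMulVec,
    Matrix.trace_vecMulVec, stageCost, dotProduct_comm _ (((A - B * K) ^ k) *ᵥ z),
    Matrix.add_mulVec, dotProduct_add]
  congr 1
  rw [Matrix.dotProduct_mulVec _ (Kᵀ * R * K), Matrix.mul_assoc, ← Matrix.vecMul_vecMul,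
    Matrix.vecMul_transpose, ← Matrix.dotProduct_mulVec, ← Matrix.mulVec_mulVec]

/-- The cost is the trace of the stage weight against the Gram matrix of the trajectories. -/
theorem cost_eq_trace (hK : K ∈ stabilizing A B) :
    cost A B Q R x K = ((Q + Kᵀ * R * K) * stateGram A B x K).trace := by
  have h1 : HasSum (fun k : ℕ => ∑ j, stageCost A B Q R (x j) K k) (cost A B Q R x K) :=
    hasSum_sum fun j _ => (summable_stageCost A B Q R (x j) K hK).hasSum
  have h2 := hasSum_trace (Q + Kᵀ * R * K) ((isSchur_of_mem hK).hasSum_lyapunov (initialGram x))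
  refine h1.unique ?_
  have hk : ∀ k : ℕ, ∑ j, stageCost A B Q R (x j) K k =
      ((Q + Kᵀ * R * K) * ((A - B * K) ^ k * initialGram x * ((A - B * K) ^ k)ᵀ)).trace := by
    intro k
    rw [initialGram_eq_sum, Matrix.mul_sum, Matrix.sum_mul, Matrix.mul_sum, Matrix.trace_sum]
    exact Finset.sum_congr rfl fun j _ => stageCost_eq_trace _ _ _
  simp only [hk]
  exact h2

theorem cost_eq_trace_valueMatrix (hK : K ∈ stabilizing A B) :
    cost A B Q R x K = (valueMatrix A B Q R K * initialGram x).trace := by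
  rw [cost_eq_trace hK]
  exact (isSchur_of_mem hK).trace_mul_lyapunov _ _

/-- The exact second-order expansion of the cost. -/
theorem cost_sub_cost (hQ : Q.PosSemidef) (hR : R.PosSemidef) (hK : K ∈ stabilizing A B)
    (hK' : K' ∈ stabilizing A B) :
    cost A B Q R x K' - cost A B Q R x K =
      ((K' - K)ᵀ * inputWeight A B Q R K * (K' - K) * stateGram A B x K').trace +
        2 * ((K' - K)ᵀ * residual A B Q R K * stateGram A B x K').trace := by
  have hXs := (posSemidef_valueMatrix hQ hR hK).transpose_eq
  have hX := valueMatrix_eq (Q := Q) (R := R) hK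
  have hY := stateGram_eq (x := x) hK'
  have hYs := (posSemidef_stateGram (x := x) hK').transpose_eq
  rw [cost_eq_trace hK', cost_eq_trace_valueMatrix hK, inputWeight, residual]
  generalize valueMatrix A B Q R K = X at *
  generalize stateGram A B x K' = Y at *
  obtain ⟨D, rfl⟩ : ∃ D, K' = K + D := ⟨K' - K, by abel⟩
  rw [add_sub_cancel_left]
  -- The equation of `Y` eliminates the initial Gram matrix, so both costs become traces against the
  -- same `Y`.
  have hS : (X * initialGram x).trace =
      ((X - (A - B * (K + D))ᵀ * X * (A - B * (K + D))) * Y).trace := by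
    generalize A - B * (K + D) = M at *
    rw [eq_sub_of_add_eq hY.symm, Matrix.mul_sub, Matrix.trace_sub, Matrix.sub_mul,
      Matrix.trace_sub]
    congr 1
    rw [← Matrix.mul_assoc, Matrix.trace_mul_comm, ← Matrix.mul_assoc, ← Matrix.mul_assoc]
  -- The two cross terms agree only under the trace, by symmetry of `Y`. Transposing one of them
  -- reduces the claim to a matrix identity.
  have hT : ∀ E : Matrix (Fin m) (Fin n) ℝ, (Eᵀ * D * Y).trace = (Dᵀ * E * Y).trace := fun E => by
    rw [← Matrix.trace_transpose, Matrix.transpose_mul, Matrix.transpose_mul,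
      Matrix.transpose_transpose, hYs, Matrix.trace_mul_comm]
  rw [hS, ← Matrix.trace_sub, ← Matrix.sub_mul, two_mul, ← add_assoc]
  nth_rw 2 [← hT]
  rw [← Matrix.trace_add, ← Matrix.trace_add, ← Matrix.add_mul, ← Matrix.add_mul]
  congr 2
  generalize hM : A - B * K = M at *
  have hM' : A - B * (K + D) = M - B * D := by rw [← hM, Matrix.mul_add]; abel
  rw [hM']
  nth_rw 1 [hX]
  simp only [Matrix.transpose_sub, Matrix.transpose_add, Matrix.transpose_mul,
    Matrix.transpose_transpose, hXs, hR.transpose_eq, Matrix.add_mul, Matrix.mul_add,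
    Matrix.sub_mul, Matrix.mul_sub, Matrix.mul_assoc]
  abel

theorem contDiffAt_stateGram (hK : K ∈ stabilizing A B) :
    ContDiffAt ℝ ∞ (stateGram A B x) K :=
  contDiffAt_lyapunov (contDiffAt_const.sub (contDiffAt_const.matrix_mul contDiffAt_id))
    contDiffAt_const hK

theorem contDiffAt_valueMatrix (hK : K ∈ stabilizing A B) :
    ContDiffAt ℝ ∞ (valueMatrix A B Q R) K :=
  contDiffAt_lyapunov
    (contDiffAt_const.sub (contDiffAt_const.matrix_mul contDiffAt_id)).matrix_transpose
    (contDiffAt_const.add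
      ((contDiffAt_id.matrix_transpose.matrix_mul contDiffAt_const).matrix_mul contDiffAt_id))
    (isSchur_of_mem hK).transpose

theorem contDiffOn_costGradient :
    ContDiffOn ℝ ∞ (costGradient A B Q R x) (stabilizing A B) := fun K hK => by
  have h1 : ContDiffAt ℝ ∞ (residual A B Q R) K :=
    (contDiffAt_const.matrix_mul contDiffAt_id).sub
      ((contDiffAt_const.matrix_mul (contDiffAt_valueMatrix hK)).matrix_mul
        (contDiffAt_const.sub (contDiffAt_const.matrix_mul contDiffAt_id)))
  exact ((h1.matrix_mul (contDiffAt_stateGram hK)).const_smul (2 : ℝ)).contDiffWithinAt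

theorem abs_trace_transpose_mul_le (E F : Matrix (Fin m) (Fin n) ℝ) :
    |(Eᵀ * F).trace| ≤ ‖E‖ * ‖F‖ := by
  rw [← frobenius_inner_eq_trace]
  exact abs_real_inner_le_norm E F

theorem hasGradientAt_cost (hQ : Q.PosSemidef) (hR : R.PosSemidef) (hK : K ∈ stabilizing A B) :
    HasGradientAt (cost A B Q R x) (costGradient A B Q R x K) K := by
  rw [hasGradientAt_iff_isLittleO, isLittleO_iff]
  intro c hc
  set Y := stateGram A B x
  set G := inputWeight A B Q R K
  set E := residual A B Q R K
  have hYc : ContinuousAt Y K := (contDiffAt_stateGram hK).continuousAt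
  -- This is the coefficient of `‖D‖` in the error bound. It vanishes at `K`, so continuity of `Y`
  -- alone already gives differentiability of the cost.
  have hlim : Tendsto (fun K' => ‖G‖ * ‖K' - K‖ * ‖Y K'‖ + 2 * (‖E‖ * ‖Y K' - Y K‖)) (𝓝 K)
      (𝓝 (‖G‖ * ‖K - K‖ * ‖Y K‖ + 2 * (‖E‖ * ‖Y K - Y K‖))) := by
    have h1 : Tendsto (fun K' : Matrix (Fin m) (Fin n) ℝ => ‖K' - K‖) (𝓝 K) (𝓝 ‖K - K‖) :=
      (tendsto_id.sub_const K).norm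
    exact ((h1.const_mul _).mul hYc.tendsto.norm).add
      (((hYc.tendsto.sub_const (Y K)).norm.const_mul _).const_mul 2)
  have hev := hlim.eventually_lt_const (u := c) (by simpa using hc)
  filter_upwards [hev, isOpen_stabilizing.mem_nhds hK] with K' hlt hK'
  have hYs : (Y K)ᵀ = Y K := (posSemidef_stateGram hK).transpose_eq
  set D := K' - K
  have hinner : inner ℝ (costGradient A B Q R x K) D = 2 * (Dᵀ * (E * Y K)).trace := by
    rw [real_inner_comm, costGradient, inner_smul_right, frobenius_inner_eq_trace]
  rw [hinner, cost_sub_cost hQ hR hK hK']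
  have heq : (Dᵀ * G * D * Y K').trace + 2 * (Dᵀ * E * Y K').trace - 2 * (Dᵀ * (E * Y K)).trace =
      (Dᵀ * (G * D * Y K')).trace + 2 * (Dᵀ * (E * (Y K' - Y K))).trace := by
    simp only [Matrix.mul_sub, Matrix.trace_sub, Matrix.mul_assoc]
    ring
  rw [heq, Real.norm_eq_abs]
  have hb1 : ‖G * D * Y K'‖ ≤ ‖G‖ * ‖D‖ * ‖Y K'‖ :=
    (Matrix.frobenius_norm_mul _ _).trans (by gcongr; exact Matrix.frobenius_norm_mul _ _)
  have hb2 : ‖E * (Y K' - Y K)‖ ≤ ‖E‖ * ‖Y K' - Y K‖ := Matrix.frobenius_norm_mul _ _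
  calc _ ≤ |(Dᵀ * (G * D * Y K')).trace| + |2 * (Dᵀ * (E * (Y K' - Y K))).trace| := abs_add_le _ _
    _ ≤ ‖D‖ * (‖G‖ * ‖D‖ * ‖Y K'‖) + 2 * (‖D‖ * (‖E‖ * ‖Y K' - Y K‖)) := by
      rw [abs_mul, abs_two]
      gcongr
      · exact (abs_trace_transpose_mul_le _ _).trans (by gcongr)
      · exact (abs_trace_transpose_mul_le _ _).trans (by gcongr)
    _ = (‖G‖ * ‖D‖ * ‖Y K'‖ + 2 * (‖E‖ * ‖Y K' - Y K‖)) * ‖D‖ := by ring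
    _ ≤ c * ‖D‖ := by gcongr

/-- A weighted trace is bounded below by the Frobenius norm. -/
theorem le_trace_mul_stateGram {σ : ℝ}
    (hσ : (initialGram x - σ • (1 : Matrix (Fin n) (Fin n) ℝ)).PosSemidef)
    (hK : K ∈ stabilizing A B) (D : Matrix (Fin m) (Fin n) ℝ) :
    σ * ‖D‖ ^ 2 ≤ (Dᵀ * D * stateGram A B x K).trace := by
  have h1 : (stateGram A B x K - σ • (1 : Matrix (Fin n) (Fin n) ℝ)).PosSemidef := by
    have := (posSemidef_stateGram_sub_initialGram (x := x) hK).add hσ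
    rwa [sub_add_sub_cancel] at this
  have hD : (Dᵀ * D).PosSemidef := by
    simpa [Matrix.conjTranspose_eq_transpose_of_trivial] using
      Matrix.posSemidef_conjTranspose_mul_self D
  have h2 := Matrix.PosSemidef.trace_mul_le_trace_mul h1 hD
  rw [Matrix.smul_mul, Matrix.one_mul, Matrix.trace_smul, smul_eq_mul,
    ← frobenius_norm_sq_eq_trace] at h2
  rwa [Matrix.trace_mul_comm (Dᵀ * D)]

theorem trace_mul_le_norm_sq {y : ℝ} {Y : Matrix (Fin n) (Fin n) ℝ}
    (hy : (y • (1 : Matrix (Fin n) (Fin n) ℝ) - Y).PosSemidef) (D : Matrix (Fin m) (Fin n) ℝ) :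
    (Dᵀ * D * Y).trace ≤ y * ‖D‖ ^ 2 := by
  have hD : (Dᵀ * D).PosSemidef := by
    simpa [Matrix.conjTranspose_eq_transpose_of_trivial] using
      Matrix.posSemidef_conjTranspose_mul_self D
  have h2 := Matrix.PosSemidef.trace_mul_le_trace_mul hy hD
  rw [Matrix.smul_mul, Matrix.one_mul, Matrix.trace_smul, smul_eq_mul,
    ← frobenius_norm_sq_eq_trace] at h2
  rwa [Matrix.trace_mul_comm (Dᵀ * D)]

theorem trace_weight_le {N N' : Matrix (Fin m) (Fin m) ℝ} (h : (N' - N).PosSemidef)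
    {Y : Matrix (Fin n) (Fin n) ℝ} (hY : Y.PosSemidef) (D : Matrix (Fin m) (Fin n) ℝ) :
    (Dᵀ * N * D * Y).trace ≤ (Dᵀ * N' * D * Y).trace := by
  refine Matrix.PosSemidef.trace_mul_le_trace_mul ?_ hY
  have := h.transpose_mul_mul_same D
  rwa [Matrix.mul_sub, Matrix.sub_mul] at this

theorem trace_smul_one_weight (r : ℝ) (D : Matrix (Fin m) (Fin n) ℝ)
    (Y : Matrix (Fin n) (Fin n) ℝ) :
    (Dᵀ * (r • (1 : Matrix (Fin m) (Fin m) ℝ)) * D * Y).trace = r * (Dᵀ * D * Y).trace := by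
  simp [Matrix.trace_smul]

/-- Cauchy-Schwarz applied to `σ‖E‖² ≤ ⟪E, E Y⟫`. With `E` the residual, it bounds the residual by
the gradient. -/
theorem le_norm_mul_stateGram {σ : ℝ}
    (hσ : (initialGram x - σ • (1 : Matrix (Fin n) (Fin n) ℝ)).PosSemidef)
    (hK : K ∈ stabilizing A B) (E : Matrix (Fin m) (Fin n) ℝ) :
    σ * ‖E‖ ≤ ‖E * stateGram A B x K‖ := by
  have h1 := le_trace_mul_stateGram hσ hK E
  have h2 : (Eᵀ * E * stateGram A B x K).trace ≤ ‖E‖ * ‖E * stateGram A B x K‖ := by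
    rw [Matrix.mul_assoc]
    exact (le_abs_self _).trans (abs_trace_transpose_mul_le _ _)
  rcases (norm_nonneg E).eq_or_lt with h | h
  · rw [← h, mul_zero]; exact norm_nonneg _
  · refine le_of_mul_le_mul_left ?_ h
    nlinarith

/-- The cost is dominated by its gradient. -/
theorem exists_gradient_dominated (hQ : Q.PosSemidef) (hR : R.PosDef)
    (hx : LinearIndependent ℝ x) (hK' : K' ∈ stabilizing A B) :
    ∃ α : ℝ, 0 < α ∧ ∀ K ∈ stabilizing A B,
      α * (cost A B Q R x K - cost A B Q R x K') ≤ ‖costGradient A B Q R x K‖ ^ 2 := by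
  obtain ⟨r, hr, hRr⟩ := hR.exists_posSemidef_sub_smul_one
  obtain ⟨σ, hσ, hσx⟩ := (posDef_initialGram hx).exists_posSemidef_sub_smul_one
  have hY := posSemidef_stateGram (x := x) hK'
  obtain ⟨y, hy, hYy⟩ := hY.isHermitian.exists_posSemidef_smul_one_sub
  -- The 4 is the square of the factor 2 in the gradient, σ² comes from passing from residual to
  -- gradient, and r / y from completing the square. Only `y` depends on `K'`, and nothing on `K`.
  refine ⟨4 * r * σ ^ 2 / y, by positivity, fun K hK => ?_⟩
  have hdiff := cost_sub_cost (x := x) hQ hR.posSemidef hK hK'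
  set D := K' - K
  set E := residual A B Q R K with hE
  set Y := stateGram A B x K'
  have hG : (inputWeight A B Q R K - r • (1 : Matrix (Fin m) (Fin m) ℝ)).PosSemidef := by
    have := (posSemidef_inputWeight_sub hQ hR.posSemidef hK).add hRr
    rwa [sub_add_sub_cancel] at this
  have h1 := trace_weight_le hG hY D
  rw [trace_smul_one_weight] at h1
  -- Completing the square: this is the `Y`-weighted square of `r D + E`. With `h1` it bounds `r (f
  -- K - f K')` by `Tr (Eᵀ E Y)`.
  have h2 : 0 ≤ r ^ 2 * (Dᵀ * D * Y).trace + 2 * r * (Dᵀ * E * Y).trace + (Eᵀ * E * Y).trace := by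
    have hT : (Eᵀ * D * Y).trace = (Dᵀ * E * Y).trace := by
      rw [← Matrix.trace_transpose, Matrix.transpose_mul, Matrix.transpose_mul,
        Matrix.transpose_transpose, hY.transpose_eq, Matrix.trace_mul_comm]
    have h := ((Matrix.PosSemidef.one (R := ℝ) (n := Fin m)).transpose_mul_mul_same
      (r • D + E)).trace_mul_nonneg hY
    have h' : ((r • D + E)ᵀ * (1 : Matrix (Fin m) (Fin m) ℝ) * (r • D + E) * Y).trace =
        r ^ 2 * (Dᵀ * D * Y).trace + r * (Dᵀ * E * Y).trace + r * (Eᵀ * D * Y).trace +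
          (Eᵀ * E * Y).trace := by
      simp only [Matrix.mul_one, Matrix.transpose_add, Matrix.transpose_smul, Matrix.add_mul,
        Matrix.mul_add, Matrix.smul_mul, Matrix.mul_smul, Matrix.trace_add, Matrix.trace_smul,
        smul_eq_mul]
      ring
    rw [h', hT] at h
    linarith
  have h3 := trace_mul_le_norm_sq hYy E
  have h4 : r * (cost A B Q R x K - cost A B Q R x K') ≤ y * ‖E‖ ^ 2 := by nlinarith
  have h5 := le_norm_mul_stateGram hσx hK E
  have h6 : ‖costGradient A B Q R x K‖ ^ 2 = 4 * ‖E * stateGram A B x K‖ ^ 2 := by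
    rw [costGradient, norm_smul, mul_pow, Real.norm_eq_abs, abs_two, hE]
    norm_num
  have h7 : (σ * ‖E‖) ^ 2 ≤ ‖E * stateGram A B x K‖ ^ 2 := by gcongr
  rw [h6, div_mul_eq_mul_div, div_le_iff₀ hy]
  calc 4 * r * σ ^ 2 * (cost A B Q R x K - cost A B Q R x K')
      = 4 * σ ^ 2 * (r * (cost A B Q R x K - cost A B Q R x K')) := by ring
    _ ≤ 4 * σ ^ 2 * (y * ‖E‖ ^ 2) := by gcongr
    _ = 4 * (σ * ‖E‖) ^ 2 * y := by ring
    _ ≤ _ := by gcongr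

/-- At a global minimizer the residual vanishes. -/
theorem IsGlobalMin.residual_eq_zero (hQ : Q.PosSemidef) (hR : R.PosSemidef)
    (hx : LinearIndependent ℝ x) (hK : IsGlobalMin (cost A B Q R x) (stabilizing A B) K) :
    residual A B Q R K = 0 := by
  have hmin : IsLocalMin (cost A B Q R x) K := by
    filter_upwards [isOpen_stabilizing.mem_nhds hK.1] with K' hK' using hK.2 K' hK'
  have h0 := hmin.hasFDerivAt_eq_zero (hasGradientAt_cost hQ hR hK.1).hasFDerivAt
  rw [map_eq_zero_iff _ (LinearIsometryEquiv.injective _), costGradient, smul_eq_zero] at h0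
  obtain ⟨σ, hσ, hσx⟩ := (posDef_initialGram hx).exists_posSemidef_sub_smul_one
  have h1 := le_norm_mul_stateGram hσx hK.1 (residual A B Q R K)
  rw [h0.resolve_left two_ne_zero, norm_zero] at h1
  have := norm_nonneg (residual A B Q R K)
  exact norm_eq_zero.1 (by nlinarith)

theorem IsGlobalMin.cost_sub_eq (hQ : Q.PosSemidef) (hR : R.PosSemidef)
    (hx : LinearIndependent ℝ x) (hK : IsGlobalMin (cost A B Q R x) (stabilizing A B) K)
    (hK' : K' ∈ stabilizing A B) :
    cost A B Q R x K' - cost A B Q R x K =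
      ((K' - K)ᵀ * inputWeight A B Q R K * (K' - K) * stateGram A B x K').trace := by
  rw [cost_sub_cost hQ hR hK.1 hK', hK.residual_eq_zero hQ hR hx]
  simp

theorem IsGlobalMin.le_cost_sub (hQ : Q.PosSemidef) (hR : R.PosSemidef)
    (hx : LinearIndependent ℝ x) (hK : IsGlobalMin (cost A B Q R x) (stabilizing A B) K)
    (hK' : K' ∈ stabilizing A B) {r : ℝ}
    (hr : (R - r • (1 : Matrix (Fin m) (Fin m) ℝ)).PosSemidef) :
    r * ((K' - K)ᵀ * (K' - K) * stateGram A B x K').trace ≤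
      cost A B Q R x K' - cost A B Q R x K := by
  have hG : (inputWeight A B Q R K - r • (1 : Matrix (Fin m) (Fin m) ℝ)).PosSemidef := by
    have := (posSemidef_inputWeight_sub hQ hR hK.1).add hr
    rwa [sub_add_sub_cancel] at this
  rw [hK.cost_sub_eq hQ hR hx hK', ← trace_smul_one_weight]
  exact trace_weight_le hG (posSemidef_stateGram hK') _

/-- Near and far from a global minimizer the cost grows at least quadratically. -/
theorem IsGlobalMin.exists_quadratic_growth (hQ : Q.PosSemidef) (hR : R.PosDef)
    (hx : LinearIndependent ℝ x) (hK : IsGlobalMin (cost A B Q R x) (stabilizing A B) K) :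
    ∃ a : ℝ, 0 < a ∧ ∀ K' ∈ stabilizing A B,
      a * ‖K' - K‖ ^ 2 ≤ cost A B Q R x K' - cost A B Q R x K := by
  obtain ⟨r, hr, hRr⟩ := hR.exists_posSemidef_sub_smul_one
  obtain ⟨σ, hσ, hσx⟩ := (posDef_initialGram hx).exists_posSemidef_sub_smul_one
  refine ⟨r * σ, by positivity, fun K' hK' => ?_⟩
  have h1 := hK.le_cost_sub hQ hR.posSemidef hx hK' hRr
  have h2 := le_trace_mul_stateGram hσx hK' (K' - K)
  rw [mul_assoc]
  exact (by gcongr : r * (σ * ‖K' - K‖ ^ 2) ≤ _).trans h1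

theorem IsGlobalMin.eq_of_isGlobalMin (hQ : Q.PosSemidef) (hR : R.PosDef)
    (hx : LinearIndependent ℝ x) (hK : IsGlobalMin (cost A B Q R x) (stabilizing A B) K)
    (hK' : IsGlobalMin (cost A B Q R x) (stabilizing A B) K') : K' = K := by
  obtain ⟨a, ha, h⟩ := hK.exists_quadratic_growth hQ hR hx
  have h1 := h K' hK'.1
  have h2 := hK'.2 K hK.1
  have h3 : ‖K' - K‖ ^ 2 ≤ 0 := by
    by_contra! hc
    nlinarith [mul_pos ha hc]
  have h4 : ‖K' - K‖ = 0 := by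
    nlinarith [norm_nonneg (K' - K)]
  exact sub_eq_zero.1 (norm_eq_zero.1 h4)

/-- The constant depends on `K'` through its Gram matrix, which is harmless since the bound is
needed at the initial gain only. -/
theorem IsGlobalMin.cost_sub_le (hQ : Q.PosSemidef) (hR : R.PosSemidef)
    (hx : LinearIndependent ℝ x) (hK : IsGlobalMin (cost A B Q R x) (stabilizing A B) K)
    (hK' : K' ∈ stabilizing A B) :
    cost A B Q R x K' - cost A B Q R x K ≤
      ‖inputWeight A B Q R K‖ * ‖stateGram A B x K'‖ * ‖K' - K‖ ^ 2 := by
  rw [hK.cost_sub_eq hQ hR hx hK']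
  set D := K' - K
  have h : (Dᵀ * inputWeight A B Q R K * D * stateGram A B x K') =
      Dᵀ * (inputWeight A B Q R K * D * stateGram A B x K') := by
    simp only [Matrix.mul_assoc]
  rw [h]
  calc _ ≤ ‖D‖ * ‖inputWeight A B Q R K * D * stateGram A B x K'‖ :=
        (le_abs_self _).trans (abs_trace_transpose_mul_le _ _)
    _ ≤ ‖D‖ * (‖inputWeight A B Q R K‖ * ‖D‖ * ‖stateGram A B x K'‖) := by
        gcongr
        exact (Matrix.frobenius_norm_mul _ _).trans
          (by gcongr; exact Matrix.frobenius_norm_mul _ _)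
    _ = _ := by ring

end LQR

end QuadraticCost

/-! ### Compactness of sublevel sets and existence of a minimizer -/

section SublevelSets

open Filter
open scoped Topology

namespace LQR

variable {m n : ℕ} {A : Matrix (Fin n) (Fin n) ℝ} {B : Matrix (Fin n) (Fin m) ℝ}
  {Q : Matrix (Fin n) (Fin n) ℝ} {R : Matrix (Fin m) (Fin m) ℝ} {x : Fin n → Fin n → ℝ}
  {K K' : Matrix (Fin m) (Fin n) ℝ}

/-- The trace of the Gram matrix of the trajectories controls the powers of the closed loop. -/
theorem sum_norm_pow_sq_le {σ : ℝ} (hσ0 : 0 < σ)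
    (hσ : (initialGram x - σ • (1 : Matrix (Fin n) (Fin n) ℝ)).PosSemidef)
    (hK : K ∈ stabilizing A B) (N : ℕ) :
    ∑ k ∈ Finset.range N, ‖(A - B * K) ^ k‖ ^ 2 ≤ (stateGram A B x K).trace / σ := by
  rw [le_div_iff₀ hσ0, Finset.sum_mul]
  have h1 := hasSum_trace 1 ((isSchur_of_mem hK).hasSum_lyapunov (initialGram x))
  simp only [Matrix.one_mul] at h1
  have h2 : ∀ k : ℕ, ‖(A - B * K) ^ k‖ ^ 2 * σ ≤
      ((A - B * K) ^ k * initialGram x * ((A - B * K) ^ k)ᵀ).trace := fun k => by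
    have h := (hσ.mul_mul_transpose_same ((A - B * K) ^ k)).trace_nonneg
    rw [Matrix.mul_sub, Matrix.sub_mul, Matrix.trace_sub, Matrix.mul_smul, Matrix.smul_mul,
      Matrix.mul_one, Matrix.trace_smul, ← frobenius_norm_sq_eq_trace_mul_transpose,
      smul_eq_mul] at h
    linarith
  refine (Finset.sum_le_sum fun k _ => h2 k).trans (sum_le_hasSum _ (fun k _ => ?_) h1)
  exact (posSemidef_initialGram.mul_mul_transpose_same _).trace_nonneg

/-- A sublevel set of the cost is compact if the gain and the Gram matrix of the trajectories are
bounded on it. -/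
theorem isCompact_sublevel (hQ : Q.PosSemidef) (hR : R.PosSemidef) (hx : LinearIndependent ℝ x)
    {c b : ℝ} (h : ∀ K ∈ stabilizing A B, cost A B Q R x K ≤ c →
      ‖K‖ ≤ b ∧ (stateGram A B x K).trace ≤ b) :
    IsCompact {K ∈ stabilizing A B | cost A B Q R x K ≤ c} := by
  obtain ⟨σ, hσ, hσx⟩ := (posDef_initialGram hx).exists_posSemidef_sub_smul_one
  -- `D` is compact and consists of stabilizing gains, so the cost is continuous on it and cuts out
  -- a closed subset.
  set D : Set (Matrix (Fin m) (Fin n) ℝ) := Metric.closedBall 0 b ∩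
    ⋂ N : ℕ, {K | ∑ k ∈ Finset.range N, ‖(A - B * K) ^ k‖ ^ 2 ≤ b / σ} with hD
  have hDc : IsCompact D := by
    refine (isCompact_closedBall _ _).inter_right (isClosed_iInter fun N => ?_)
    have hcont : Continuous fun K : Matrix (Fin m) (Fin n) ℝ =>
        ∑ k ∈ Finset.range N, ‖(A - B * K) ^ k‖ ^ 2 := by fun_prop
    exact isClosed_le hcont continuous_const
  have hDS : D ⊆ stabilizing A B := fun K hK =>
    isSchur_of_sum_norm_pow_sq_le (b := b / σ) fun N => mem_iInter.1 hK.2 N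
  have heq : {K ∈ stabilizing A B | cost A B Q R x K ≤ c} =
      D ∩ cost A B Q R x ⁻¹' Iic c := by
    ext K
    refine ⟨fun hK => ⟨⟨?_, mem_iInter.2 fun N => ?_⟩, hK.2⟩, fun hK => ⟨hDS hK.1, hK.2⟩⟩
    · simpa using (h K hK.1 hK.2).1
    · exact (sum_norm_pow_sq_le hσ hσx hK.1 N).trans (by gcongr; exact (h K hK.1 hK.2).2)
  have hcont : ContinuousOn (cost A B Q R x) D := fun K hK =>
    (hasGradientAt_cost hQ hR (hDS hK)).differentiableAt.continuousAt.continuousWithinAt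
  rw [heq]
  exact hDc.of_isClosed_subset (hcont.preimage_isClosed_of_isClosed hDc.isClosed isClosed_Iic)
    inter_subset_left

theorem isCompact_sublevel_of_posDef (hQ : Q.PosDef) (hR : R.PosDef)
    (hx : LinearIndependent ℝ x) (c : ℝ) :
    IsCompact {K ∈ stabilizing A B | cost A B Q R x K ≤ c} := by
  obtain ⟨σ, hσ, hσx⟩ := (posDef_initialGram hx).exists_posSemidef_sub_smul_one
  obtain ⟨r, hr, hRr⟩ := hR.exists_posSemidef_sub_smul_one
  obtain ⟨q, hq, hQq⟩ := hQ.exists_posSemidef_sub_smul_one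
  -- Both bounds come from `q Tr Y + r σ ‖K‖² ≤ f K ≤ c`.
  refine isCompact_sublevel (b := max (Real.sqrt (c / (r * σ))) (c / q)) hQ.posSemidef
    hR.posSemidef hx fun K hK hc => ?_
  have hY := posSemidef_stateGram (x := x) hK
  rw [cost_eq_trace hK, Matrix.add_mul, Matrix.trace_add] at hc
  have h1 := Matrix.PosSemidef.trace_mul_le_trace_mul hQq hY
  have h2 := trace_weight_le hRr hY K
  have h3 := le_trace_mul_stateGram hσx hK K
  have h4 := hY.trace_nonneg
  rw [Matrix.smul_mul, Matrix.one_mul, Matrix.trace_smul, smul_eq_mul] at h1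
  rw [trace_smul_one_weight] at h2
  have h5 : r * (σ * ‖K‖ ^ 2) ≤ r * (Kᵀ * K * stateGram A B x K).trace := by gcongr
  constructor
  · refine le_max_of_le_left (Real.le_sqrt_of_sq_le ?_)
    rw [le_div_iff₀ (by positivity)]
    nlinarith [mul_nonneg hq.le h4]
  · refine le_max_of_le_right ?_
    rw [le_div_iff₀ hq]
    have : 0 ≤ r * (σ * ‖K‖ ^ 2) := by positivity
    linarith

/-- If `K` is stabilizing, then the trajectories of any other stabilizing closed loop are controlled
by the deviation of its inputs from those of the gain `K`. -/
theorem exists_trace_stateGram_le (x : Fin n → Fin n → ℝ) (hK : K ∈ stabilizing A B) :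
    ∃ a b : ℝ, 0 ≤ b ∧ ∀ K' ∈ stabilizing A B, (stateGram A B x K').trace ≤
      a + b * ((K' - K)ᵀ * (K' - K) * stateGram A B x K').trace := by
  have hS := isSchur_of_mem hK
  -- `P` defines a Lyapunov function of the reference loop: one step with gain `K` lowers `Tr (P Y)`
  -- by `Tr Y`.
  set P := lyapunov (A - B * K)ᵀ 1 with hPdef
  have hP : P.PosSemidef := hS.transpose.posSemidef_lyapunov Matrix.PosSemidef.one
  have hPeq : P = 1 + (A - B * K)ᵀ * P * (A - B * K) := by
    have h := hS.transpose.lyapunov_eq 1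
    rwa [Matrix.transpose_transpose] at h
  obtain ⟨p, hp, hPp⟩ := hP.isHermitian.exists_posSemidef_smul_one_sub
  obtain ⟨β, hβ, hPβ⟩ :=
    (hP.transpose_mul_mul_same B).isHermitian.exists_posSemidef_smul_one_sub
  refine ⟨2 * (P * initialGram x).trace, 2 * (1 + 2 * p) * β, by positivity, fun K' hK' => ?_⟩
  have hY := posSemidef_stateGram (x := x) hK'
  have hYeq := stateGram_eq (x := x) hK'
  generalize stateGram A B x K' = Y at *
  generalize hMdef : A - B * K = M at *
  set D := K' - K with hDdef
  have hM' : A - B * K' = M - B * D := by rw [← hMdef, hDdef, Matrix.mul_sub]; abel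
  rw [hM'] at hYeq
  have h1 : (P * Y).trace = (P * initialGram x).trace +
      ((M - B * D)ᵀ * P * (M - B * D) * Y).trace := by
    conv_lhs => rw [hYeq]
    generalize M - B * D = L
    rw [Matrix.mul_add, Matrix.trace_add, ← Matrix.mul_assoc, Matrix.trace_mul_comm _ Lᵀ,
      ← Matrix.mul_assoc, ← Matrix.mul_assoc]
  -- This ε makes `ε P ⪯ 1/2`, so the error `ε Tr (P Y)` is absorbed by half of `Tr Y`; hence the
  -- factors 2 in the constants.
  set ε : ℝ := 1 / (2 * p) with hε
  have hε0 : 0 < ε := by positivity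
  -- Young's inequality in matrix form: nonnegativity of this square gives `T ≤ (1 + ε) Tr (Mᵀ P M
  -- Y) + (1 + 1/ε) W`, where `1/ε = 2p`.
  have h2 := (hP.transpose_mul_mul_same (ε • M + B * D)).trace_mul_nonneg hY
  have h3 : ((ε • M + B * D)ᵀ * P * (ε • M + B * D) * Y).trace =
      ε * ((1 + ε) * (Mᵀ * P * M * Y).trace - ((M - B * D)ᵀ * P * (M - B * D) * Y).trace) +
        (1 + ε) * (Dᵀ * (Bᵀ * P * B) * D * Y).trace := by
    simp only [Matrix.transpose_add, Matrix.transpose_sub, Matrix.transpose_smul,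
      Matrix.transpose_mul, Matrix.add_mul, Matrix.mul_add, Matrix.sub_mul, Matrix.mul_sub,
      Matrix.smul_mul, Matrix.mul_smul, Matrix.trace_add, Matrix.trace_sub, Matrix.trace_smul,
      smul_eq_mul, Matrix.mul_assoc]
    ring
  have h4 : (Mᵀ * P * M * Y).trace = (P * Y).trace - Y.trace := by
    have h : Mᵀ * P * M = P - 1 := (sub_eq_of_eq_add' hPeq).symm
    rw [h, Matrix.sub_mul, Matrix.trace_sub, Matrix.one_mul]
  have h5 := trace_weight_le hPβ hY D
  rw [trace_smul_one_weight] at h5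
  have h6 := Matrix.PosSemidef.trace_mul_le_trace_mul hPp hY
  rw [Matrix.smul_mul, Matrix.one_mul, Matrix.trace_smul, smul_eq_mul] at h6
  rw [h3, h4] at h2
  set T := ((M - B * D)ᵀ * P * (M - B * D) * Y).trace
  set W := (Dᵀ * (Bᵀ * P * B) * D * Y).trace
  have hεp : 2 * p * ε = 1 := by rw [hε]; field_simp
  have h7 : T ≤ (1 + ε) * ((P * Y).trace - Y.trace) + (1 + 2 * p) * W := by
    have h8 : 0 ≤ 2 * p * (ε * ((1 + ε) * ((P * Y).trace - Y.trace) - T) + (1 + ε) * W) := by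
      positivity
    have h9 : 2 * p * (ε * ((1 + ε) * ((P * Y).trace - Y.trace) - T) + (1 + ε) * W) =
        2 * p * ε * ((1 + ε) * ((P * Y).trace - Y.trace) - T) + (2 * p + 2 * p * ε) * W := by ring
    rw [h9, hεp] at h8
    linarith
  have h10 : ε * (P * Y).trace ≤ Y.trace / 2 := by
    calc ε * (P * Y).trace ≤ ε * (p * Y.trace) := by gcongr
      _ = 2 * p * ε * Y.trace / 2 := by ring
      _ = _ := by rw [hεp, one_mul]
  have h11 : (1 + 2 * p) * W ≤ (1 + 2 * p) * (β * (Dᵀ * D * Y).trace) := by gcongr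
  have h12 : 0 ≤ ε * Y.trace := mul_nonneg hε0.le hY.trace_nonneg
  linarith

/-- For semidefinite `Q` the cost need not see every state. The minimizer makes up for this:
quadratic growth bounds the gain, and the excess cost bounds the weighted input deviation, hence the
Gram matrix. -/
theorem IsGlobalMin.isCompact_sublevel (hQ : Q.PosSemidef) (hR : R.PosDef)
    (hx : LinearIndependent ℝ x) (hK : IsGlobalMin (cost A B Q R x) (stabilizing A B) K) (c : ℝ) :
    IsCompact {K ∈ stabilizing A B | cost A B Q R x K ≤ c} := by
  obtain ⟨r, hr, hRr⟩ := hR.exists_posSemidef_sub_smul_one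
  obtain ⟨q, hq, hgrow⟩ := hK.exists_quadratic_growth hQ hR hx
  obtain ⟨a, b, hb, htr⟩ := exists_trace_stateGram_le x hK.1
  set d := c - cost A B Q R x K
  refine LQR.isCompact_sublevel (b := max (‖K‖ + Real.sqrt (d / q)) (a + b * (d / r))) hQ
    hR.posSemidef hx fun K' hK' hc => ?_
  have hd : cost A B Q R x K' - cost A B Q R x K ≤ d := sub_le_sub_right hc _
  constructor
  · refine le_max_of_le_left ?_
    have h1 : ‖K' - K‖ ≤ Real.sqrt (d / q) := by
      refine Real.le_sqrt_of_sq_le ?_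
      rw [le_div_iff₀ hq, mul_comm]
      exact (hgrow K' hK').trans hd
    calc ‖K'‖ = ‖K + (K' - K)‖ := by rw [add_sub_cancel]
      _ ≤ ‖K‖ + ‖K' - K‖ := norm_add_le _ _
      _ ≤ _ := by gcongr
  · refine le_max_of_le_right ((htr K' hK').trans ?_)
    gcongr
    rw [le_div_iff₀ hr, mul_comm]
    exact (hK.le_cost_sub hQ hR.posSemidef hx hK' hRr).trans hd

theorem exists_isGlobalMin (hQ : Q.PosDef) (hR : R.PosDef) (hx : LinearIndependent ℝ x)
    (hK : K ∈ stabilizing A B) :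
    ∃ Kstar, IsGlobalMin (cost A B Q R x) (stabilizing A B) Kstar := by
  obtain ⟨Kstar, hS, hmin⟩ := (isCompact_sublevel_of_posDef (A := A) (B := B) hQ hR hx
    (cost A B Q R x K)).exists_isMinOn ⟨K, hK, le_rfl⟩ fun K' hK' =>
      (hasGradientAt_cost hQ.posSemidef hR.posSemidef
        hK'.1).differentiableAt.continuousAt.continuousWithinAt
  refine ⟨Kstar, hS.1, fun K' hK' => ?_⟩
  rcases le_total (cost A B Q R x K') (cost A B Q R x K) with h | h
  · exact hmin ⟨hK', h⟩
  · exact hS.2.trans h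

end LQR

end SublevelSets

theorem mainTheorem4 {m n : ℕ}
    (A : Matrix (Fin n) (Fin n) ℝ) (B : Matrix (Fin n) (Fin m) ℝ)
    (Q : Matrix (Fin n) (Fin n) ℝ) (R : Matrix (Fin m) (Fin m) ℝ)
    (hQ : Q.PosSemidef) (hR : R.PosDef)
    (x : Fin n → Fin n → ℝ) (hx : LinearIndependent ℝ x)
    (K₀ : Matrix (Fin m) (Fin n) ℝ) (hK₀ : K₀ ∈ LQR.stabilizing A B) :
    -- for `Q ≻ 0` the cost has a global minimizer over the stabilizing gains
    (Q.PosDef → ∃ Kstar, LQR.IsGlobalMin (LQR.cost A B Q R x) (LQR.stabilizing A B) Kstar) ∧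
    ∀ Kstar, LQR.IsGlobalMin (LQR.cost A B Q R x) (LQR.stabilizing A B) Kstar →
      -- the global minimizer is unique
      (∀ K', LQR.IsGlobalMin (LQR.cost A B Q R x) (LQR.stabilizing A B) K' → K' = Kstar) ∧
      ∃ K : ℝ → Matrix (Fin m) (Fin n) ℝ,
        -- `K` is a smooth solution for all time
        K 0 = K₀ ∧
        LQR.IsGradientFlow (LQR.cost A B Q R x) (LQR.stabilizing A B) K (Ici 0) ∧
        ContDiffOn ℝ ∞ K (Ici 0) ∧
        -- every solution on an interval that starts at time `0` agrees with `K` there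
        (∀ (I : Set ℝ) (L : ℝ → Matrix (Fin m) (Fin n) ℝ),
          I ⊆ Ici 0 → I.OrdConnected → 0 ∈ I → L 0 = K₀ →
          LQR.IsGradientFlow (LQR.cost A B Q R x) (LQR.stabilizing A B) L I → EqOn L K I) ∧
        -- exponential decay of the cost and exponential stability of the trajectory
        ∃ α c : ℝ, 0 < α ∧ 0 < c ∧
          ∀ t : ℝ, 0 ≤ t →
            LQR.cost A B Q R x (K t) - LQR.cost A B Q R x Kstar ≤
                Real.exp (-α * t) *
                  (LQR.cost A B Q R x K₀ - LQR.cost A B Q R x Kstar) ∧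
            ‖K t - Kstar‖ ^ 2 ≤ c * Real.exp (-α * t) * ‖K₀ - Kstar‖ ^ 2 := by

  have hRs := hR.posSemidef
  refine ⟨fun hQ' => LQR.exists_isGlobalMin hQ' hR hx hK₀, fun Kstar hmin =>
    ⟨fun K' hK' => hmin.eq_of_isGlobalMin hQ hR hx hK', ?_⟩⟩
  have hgrad : ∀ K ∈ LQR.stabilizing A B,
      HasGradientAt (LQR.cost A B Q R x) (LQR.costGradient A B Q R x K) K :=
    fun K hK => LQR.hasGradientAt_cost hQ hRs hK
  obtain ⟨K, hK0, hKsmooth, hKflow, hKuniq⟩ := exists_gradientFlow_of_isCompact_sublevel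
    LQR.isOpen_stabilizing LQR.contDiffOn_costGradient hgrad hK₀
    (hmin.isCompact_sublevel hQ hR hx _)
  obtain ⟨α, hα, hdom⟩ := LQR.exists_gradient_dominated (x := x) hQ hR hx hmin.1
  obtain ⟨a, ha, hgrow⟩ := hmin.exists_quadratic_growth hQ hR hx
  -- `C` bounds the initial excess cost by the squared initial distance and `a` is the growth
  -- constant. Their quotient would do for `c`, but `C` may be zero, hence `(C + 1) / a`.
  set C := ‖LQR.inputWeight A B Q R Kstar‖ * ‖LQR.stateGram A B x K₀‖ with hC
  have hdecay : ∀ t : ℝ, 0 ≤ t → LQR.cost A B Q R x (K t) - LQR.cost A B Q R x Kstar ≤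
      Real.exp (-α * t) * (LQR.cost A B Q R x K₀ - LQR.cost A B Q R x Kstar) := fun t ht => by
    have h := exp_decay_of_gradient_dominated hgrad hdom hKflow ht
    rwa [hK0] at h
  refine ⟨K, hK0, fun t ht => ?_, hKsmooth.contDiffOn, fun I L hI hIc h0 hL0 hL => ?_,
    α, (C + 1) / a, hα, by positivity, fun t ht => ⟨hdecay t ht, ?_⟩⟩
  · obtain ⟨hS, hd⟩ := hKflow t ht
    refine ⟨hS, (hgrad _ hS).differentiableAt, ?_⟩
    rw [(hgrad _ hS).gradient]
    exact hd.hasDerivWithinAt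
  · refine hKuniq I L hI hIc h0 hL0 fun t ht => ?_
    obtain ⟨hS, -, hd⟩ := hL t ht
    rw [(hgrad _ hS).gradient] at hd
    exact ⟨hS, hd⟩
  · have h1 := (hgrow _ (hKflow t ht).1).trans (hdecay t ht)
    have h2 := hmin.cost_sub_le hQ hRs hx hK₀
    have h3 : LQR.cost A B Q R x K₀ - LQR.cost A B Q R x Kstar ≤ (C + 1) * ‖K₀ - Kstar‖ ^ 2 :=
      h2.trans (by gcongr; linarith)
    rw [div_mul_eq_mul_div, div_mul_eq_mul_div, le_div_iff₀ ha, mul_comm]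
    calc a * ‖K t - Kstar‖ ^ 2
        ≤ Real.exp (-α * t) * (LQR.cost A B Q R x K₀ - LQR.cost A B Q R x Kstar) := h1
      _ ≤ Real.exp (-α * t) * ((C + 1) * ‖K₀ - Kstar‖ ^ 2) := by gcongr
      _ = _ := by ring
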